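/- Fix an optimal conditional decompressor, and let $C(u)$ and $C(u|v)$ denote the plain and the conditional Kolmogorov complexity of binary strings with respect to it; conditioning on several strings means conditioning on a standard code of the tuple, e.g. $C(x|p,z)=C(x|\langle p,z\rangle)$. Put $I(u:v)=C(v)-C(v|u)$ and $I(u:v|w)=C(v|w)-C(v|u,w)$. An approximate equality $A\approx B$ means $|A-B|\le c\cdot\log N$ for a constant $c$, where $N$ is the sum of the lengths of all strings involved: $|x|+|y|$ in the assumptions on $(x,y)$, $|x|+|y|+|z|$ in the claims on $z$, and $|x|+|y|+|z|+|p|$ in the claims on $p$ (logarithms are replaced by a positive constant when $N\le 1$). A string $p$ is called useful to get $x$ from $y$ if $C(x|p,y)\approx 0$. (1) Let $d\ge 1$ and $n\ge 0$ be integers and let $x,y$ be binary strings with $C(x)\approx n$, $C(y)\approx n$ and $I(x:y)\approx 0$. Then there is a string $z$ of length $(d+1)n$ such that $$C(z)\approx (d+1)n,\qquad I(x:z)\approx 0,\qquad I(y:z)\approx 0,$$ and such that for every string $p$ of length $\mathrm{poly}(n)$ with $I(p:z|x,y)\approx 0$: if $p$ is useful to get $x$ from $y$, then $p$ is useful to get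 $x$ from $z$. Here the constants in the claims on $z$ depend only on the constant in the assumptions on $(x,y)$; the constant in the last conclusion depends only on that constant, on the polynomial that bounds $|p|$ and on the constant in the two assumptions on $p$; the string $z$ depends neither on $p$ nor on this polynomial and the constant in the assumptions on $p$. None of the constants depends on $d$, $n$, $x$, $y$. (2) Consequently, the question whether for all strings $x,y,z$ there is a string $p$ of length polynomial in $|x|+|y|+|z|$ with $C(x|p,y)\approx 0$ and $C(x|p,z)\approx\min\{C(x|z),C(y|z)\}$ has a negative answer if $p$ is required to satisfy $I(p:z|x,y)\approx 0$: for every polynomial $P$ and every constant $c$ there are strings $x,y,z$ such that no $p$ with $|p|\le P(|x|+|y|+|z|)$ satisfies these three approximate equalities with precision $c\log N$. -/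

import Mathlib

/-- Finite binary strings. -/
abbrev BitString : Type := List Bool

namespace BitString

/-- A decompressor: a partial computable map taking a program `p` and a condition `y`
to an output string. -/
def IsDecompressor (D : BitString → BitString →. BitString) : Prop :=
  Partrec₂ D

/-- An optimal decompressor: it simulates every decompressor
with programs that are longer by at most an additive constant. -/
def IsOptimal (D : BitString → BitString →. BitString) : Prop :=
  IsDecompressor D ∧
    ∀ D' : BitString → BitString →. BitString, IsDecompressor D' →
      ∃ c : ℕ, ∀ p x y : BitString, x ∈ D' p y →
        ∃ p' : BitString, x ∈ D p' y ∧ p'.length ≤ p.length + c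

/-- Conditional plain Kolmogorov complexity `C(x | y)` with respect to `D`: the length of a shortest
program that maps `y` to `x`. For an optimal `D` such a program always exists. -/
noncomputable def condC (D : BitString → BitString →. BitString) (x y : BitString) : ℕ :=
  sInf {l : ℕ | ∃ p : BitString, x ∈ D p y ∧ p.length = l}

/-- Plain Kolmogorov complexity `C(x)`: the condition is the empty string. -/
noncomputable def plainC (D : BitString → BitString →. BitString) (x : BitString) : ℕ :=
  condC D x []

/-- A code of the pair of strings `(x, y)`: the string `1^|x| 0 x y`. -/
def pair (x y : BitString) : BitString :=
  List.replicate x.length true ++ false :: (x ++ y)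

/-- The information in `x` on `y`: `I(x : y) = C(y) - C(y | x)`. -/
noncomputable def info (D : BitString → BitString →. BitString) (x y : BitString) : ℤ :=
  (plainC D y : ℤ) - condC D y x

/-- The information in `x` on `y` conditional on `z`: `I(x : y | z) = C(y | z) - C(y | x, z)`. -/
noncomputable def condInfo (D : BitString → BitString →. BitString) (x y z : BitString) : ℤ :=
  (condC D y z : ℤ) - condC D y (pair x z)

/-- `A` and `B` differ by at most `c` times the (integer part of the binary) logarithm of `N`.
The shift `N + 2` only serves to make the logarithm positive for `N = 0` and `N = 1`. -/
def ApproxEq (c N : ℕ) (A B : ℤ) : Prop :=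
  |A - B| ≤ (c : ℤ) * (Nat.log 2 (N + 2) : ℤ)

/-- The string `p` is useful to get `x` given `y`: the complexity `C(x | p, y)` vanishes
up to `c` times the logarithm of `N`. -/
def Useful (D : BitString → BitString →. BitString) (c N : ℕ) (p x y : BitString) : Prop :=
  ApproxEq c N (condC D x (pair p y)) 0

/-- Optimal decompressors exist. -/
theorem exists_isOptimal : ∃ D : BitString → BitString →. BitString, IsOptimal D := by
  have hk : Primrec (fun a : BitString × BitString => (a.1.takeWhile id).length) :=
    Primrec.list_length.comp ((Primrec.list_takeWhile (p := id) Primrec.id).comp Primrec.fst)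
  have hr : Primrec (fun a : BitString × BitString => (a.1.dropWhile id).tail) :=
    Primrec.list_tail.comp ((Primrec.list_dropWhile (p := id) Primrec.id).comp Primrec.fst)
  refine ⟨fun p y =>
    (Nat.Partrec.Code.eval (Denumerable.ofNat Nat.Partrec.Code (p.takeWhile id).length)
      (Encodable.encode ((p.dropWhile id).tail, y))).bind
        (fun n => (Encodable.decode (α := BitString) n : Part BitString)), ?_, ?_⟩
  · have h1 : Partrec (fun a : BitString × BitString =>
        Nat.Partrec.Code.eval (Denumerable.ofNat Nat.Partrec.Code (a.1.takeWhile id).length)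
          (Encodable.encode ((a.1.dropWhile id).tail, a.2))) :=
      Nat.Partrec.Code.eval_part.comp
        ((Computable.ofNat Nat.Partrec.Code).comp hk.to_comp)
        (Computable.encode.comp (hr.to_comp.pair Computable.snd))
    have h2 : Partrec₂ (fun (_ : BitString × BitString) (n : ℕ) =>
        (Encodable.decode (α := BitString) n : Part BitString)) :=
      (Computable.decode.comp Computable.snd).ofOption
    exact h1.bind h2
  · intro D' hD'
    obtain ⟨e, he⟩ := Nat.Partrec.Code.exists_code.1 hD'
    refine ⟨Encodable.encode e + 1, fun p x y hx =>
      ⟨List.replicate (Encodable.encode e) true ++ false :: p, ?_, ?_⟩⟩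
    · have t1 : ((List.replicate (Encodable.encode e) true ++ false :: p).takeWhile id).length
          = Encodable.encode e := by
        rw [List.takeWhile_append_of_pos (by simp)]
        simp
      have t2 : ((List.replicate (Encodable.encode e) true ++ false :: p).dropWhile id).tail
          = p := by
        rw [List.dropWhile_append_of_pos (by simp)]
        simp
      refine Part.mem_bind_iff.2 ⟨Encodable.encode x, ?_, ?_⟩
      · have h3 : Encodable.encode x ∈ e.eval (Encodable.encode (p, y)) := by
          rw [he]
          simp only [Encodable.encodek, Part.coe_some, Part.bind_some, Part.mem_map_iff]
          exact ⟨x, hx, rfl⟩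
        rw [t1, t2, Denumerable.ofNat_encode]
        exact h3
      · simp
    · simp
      omega

end BitString

open BitString

/-! Let q be the largest prime not exceeding 2^n. Since x and y have complexity about n, each can be
replaced, up to O(log N) bits of information both ways, by a residue modulo q
(`IsOptimal.exists_isFingerprint`): x by u and y by w. So (u, w) is a point of the affine plane over
the field with q elements. The string z codes a line of nonzero slope through this point, followed
by r = (d-1)n more bits, chosen so that C(z|x,y) ≥ n + r - 1. There are enough such strings for this
by `le_card_linesThrough`.

Given x, the string z yields u and then w, hence essentially y. The chain rule then gives C(z|x) ≥
C(y|x) + C(z|x,y) - O(log N), which is about 2n + r = |z|. The same holds with x and y exchanged, so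
z is independent of each of them (`IsOptimal.exists_condC_add_le`).

Let p be useful to get x from y. Then a program g of length O(log N) maps (p, w) to u. Call a point
(u', w') of the line fixed if g maps (p, w') to u'. If fewer than O(2^k) points are fixed, with k =
O(log N), then u is found from p and z by its number in the enumeration of fixed points
(`IsOptimal.exists_condC_fixed_le`). If more are fixed, then z is one of few lines: the graph of
g(p, ·) has at most one point over each of the 2^n values w', and a point other than (u, w) lies on
at most one line through (u, w). Hence at most 2^(n+r-k) strings code a line with 2^k further fixed
points (`card_mul_le_of_many_points`), and C(z|p,u,w) drops below n + r by about k
(`IsOptimal.exists_condC_line_add_le`). For k a large multiple of log N this contradicts I(p:z|x,y)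
≈ 0. `IsOptimal.exists_condC_le_of_isWitness` combines the two cases.

For the negative answer take x random of length n, y random given x, and d = 1. By symmetry of
information C(x|z) and C(y|z) are about n, whereas a p with the first two properties gives C(x|p,z)
= O(log N), and log N is o(n) when |p| is polynomially bounded. -/

namespace BitString

/-! ### Semidecidable predicates: closure properties and uniformization. -/

section Semidecidable

variable {α β γ : Type*} [Primcodable α] [Primcodable β] [Primcodable γ]

/-- A semidecidable predicate, presented as the projection of a primitive recursive relation. -/
def Semi (p : α → Prop) : Prop :=
  ∃ R : α → ℕ → Prop, PrimrecRel R ∧ ∀ a, p a ↔ ∃ t, R a t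

theorem Semi.of_eq {p q : α → Prop} (hp : Semi p) (h : ∀ a, p a ↔ q a) : Semi q := by
  obtain ⟨R, hR, hp⟩ := hp
  exact ⟨R, hR, fun a => (h a).symm.trans (hp a)⟩

theorem Semi.of_primrec {p : α → Prop} (hp : PrimrecPred p) : Semi p :=
  ⟨fun a _ => p a, hp.comp Primrec.fst, fun a => by simp⟩

theorem Semi.comp {p : β → Prop} (hp : Semi p) {f : α → β} (hf : Primrec f) :
    Semi fun a => p (f a) := by
  obtain ⟨R, hR, hp⟩ := hp
  exact ⟨fun a t => R (f a) t, hR.comp (hf.comp Primrec.fst) Primrec.snd, fun a => hp _⟩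

/-- Dovetailing: one natural number codes both the witness and the stage at which it is confirmed.
-/
theorem Semi.exists {p : α → β → Prop} (hp : Semi fun a : α × β => p a.1 a.2) :
    Semi fun a => ∃ b, p a b := by
  classical
  obtain ⟨R, hR, hp⟩ := hp
  refine ⟨fun a n => ((Encodable.decode (α := β × ℕ) n).bind
    fun b => if R (a, b.1) b.2 then some () else none) = some (), ?_, fun a => ?_⟩
  · refine Primrec.eq.comp (Primrec.option_bind (Primrec.decode.comp Primrec.snd) ?_)
      (Primrec.const _)
    exact Primrec.ite (hR.comp
      (Primrec.pair (Primrec.fst.comp Primrec.fst) (Primrec.fst.comp Primrec.snd))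
      (Primrec.snd.comp Primrec.snd)) (Primrec.const _) (Primrec.const _)
  · constructor
    · rintro ⟨b, hb⟩
      obtain ⟨t, ht⟩ := (hp (a, b)).1 hb
      exact ⟨Encodable.encode (b, t), by simp [ht]⟩
    · rintro ⟨n, hn⟩
      obtain ⟨⟨b, t⟩, -, h2⟩ := Option.bind_eq_some_iff.1 hn
      refine ⟨b, (hp (a, b)).2 ⟨t, ?_⟩⟩
      by_contra h
      simp [h] at h2

theorem Semi.and {p q : α → Prop} (hp : Semi p) (hq : Semi q) : Semi fun a => p a ∧ q a := by
  obtain ⟨R, hR, hp⟩ := hp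
  obtain ⟨S, hS, hq⟩ := hq
  have : Semi fun a => ∃ t : ℕ × ℕ, R a t.1 ∧ S a t.2 := by
    refine Semi.exists (Semi.of_primrec (PrimrecPred.and ?_ ?_))
    · exact hR.comp Primrec.fst (Primrec.fst.comp Primrec.snd)
    · exact hS.comp Primrec.fst (Primrec.snd.comp Primrec.snd)
  refine this.of_eq fun a => ?_
  rw [hp, hq]
  constructor
  · rintro ⟨t, h1, h2⟩
    exact ⟨⟨_, h1⟩, ⟨_, h2⟩⟩
  · rintro ⟨⟨s, h1⟩, ⟨t, h2⟩⟩
    exact ⟨(s, t), h1, h2⟩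

/-- Finitely many elements need finitely many stages, so a certificate is the list itself with a
stage attached to every entry. -/
theorem Semi.forall_mem {p : β → α → Prop} (hp : Semi fun a : β × α => p a.1 a.2) :
    Semi fun a : List β × α => ∀ b ∈ a.1, p b a.2 := by
  obtain ⟨R, hR, hp⟩ := hp
  have : Semi fun a : List β × α =>
      ∃ T : List (β × ℕ), T.map Prod.fst = a.1 ∧ ∀ b ∈ T, R (b.1, a.2) b.2 := by
    refine Semi.exists (Semi.of_primrec (PrimrecPred.and ?_ ?_))
    · exact Primrec.eq.comp (Primrec.list_map Primrec.snd (Primrec.fst.comp Primrec.snd).to₂)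
        (Primrec.fst.comp Primrec.fst)
    · have h : PrimrecRel fun (b : β × ℕ) (a : List β × α) => R (b.1, a.2) b.2 :=
        hR.comp (Primrec.pair (Primrec.fst.comp Primrec.fst) (Primrec.snd.comp Primrec.snd))
          (Primrec.snd.comp Primrec.fst)
      exact h.forall_mem_list.comp Primrec.snd Primrec.fst
  refine this.of_eq fun a => ?_
  constructor
  · rintro ⟨T, h1, h2⟩ b hb
    rw [← h1] at hb
    obtain ⟨⟨b', t⟩, h3, rfl⟩ := List.mem_map.1 hb
    exact (hp _).2 ⟨t, h2 _ h3⟩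
  · intro h
    have h' : ∀ b ∈ a.1, ∃ t, R (b, a.2) t := fun b hb => (hp (b, a.2)).1 (h b hb)
    choose! f hf using h'
    refine ⟨a.1.map fun b => (b, f b), ?_, ?_⟩
    · simp [Function.comp_def]
    · intro b hb
      obtain ⟨b', h3, rfl⟩ := List.mem_map.1 hb
      exact hf _ h3

/-- A partial recursive uniformization of a semidecidable relation. -/
theorem Semi.exists_partrec {p : α → β → Prop} (hp : Semi fun a : α × β => p a.1 a.2) :
    ∃ f : α →. β, Partrec f ∧ (∀ a b, b ∈ f a → p a b) ∧ ∀ a, (∃ b, p a b) → ∃ b, b ∈ f a := by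
  classical
  obtain ⟨R, hR, hp⟩ := hp
  set g : α → ℕ → Option β := fun a n => (Encodable.decode (α := β × ℕ) n).bind
    fun b => if R (a, b.1) b.2 then some b.1 else none with hg
  have hg' : Primrec₂ g := by
    refine Primrec.option_bind (Primrec.decode.comp Primrec.snd) ?_
    exact Primrec.ite (hR.comp
      (Primrec.pair (Primrec.fst.comp Primrec.fst) (Primrec.fst.comp Primrec.snd))
      (Primrec.snd.comp Primrec.snd))
      (Primrec.option_some.comp (Primrec.fst.comp Primrec.snd)) (Primrec.const _)
  refine ⟨fun a => Nat.rfindOpt (g a), Partrec.rfindOpt hg'.to_comp, fun a b hb => ?_, ?_⟩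
  · obtain ⟨n, hn⟩ := Nat.rfindOpt_spec hb
    obtain ⟨⟨b', t⟩, -, h2⟩ := Option.bind_eq_some_iff.1 hn
    by_cases h : R (a, b') t
    · simp only [h, if_true, Option.some.injEq] at h2
      exact (hp (a, b)).2 ⟨t, h2 ▸ h⟩
    · simp [h] at h2
  · rintro a ⟨b, hb⟩
    obtain ⟨t, ht⟩ := (hp (a, b)).1 hb
    refine Part.dom_iff_mem.1 (Nat.rfindOpt_dom.2 ⟨Encodable.encode (b, t), b, ?_⟩)
    simp [hg, ht]

theorem semi_graph {f : α →. β} (hf : Partrec f) : Semi fun a : α × β => a.2 ∈ f a.1 := by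
  obtain ⟨c, hc⟩ := Nat.Partrec.Code.exists_code.1 hf
  refine ⟨fun a k => Nat.Partrec.Code.evaln k c (Encodable.encode a.1)
    = some (Encodable.encode a.2), ?_, fun a => ?_⟩
  · refine Primrec.eq.comp (Nat.Partrec.Code.primrec_evaln.comp
      (Primrec.pair (Primrec.pair Primrec.snd (Primrec.const c))
        (Primrec.encode.comp (Primrec.fst.comp Primrec.fst)))) ?_
    exact Primrec.option_some.comp (Primrec.encode.comp (Primrec.snd.comp Primrec.fst))
  · have h : Encodable.encode a.2 ∈ c.eval (Encodable.encode a.1) ↔ a.2 ∈ f a.1 := by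
      rw [hc]
      simp
    exact h.symm.trans Nat.Partrec.Code.evaln_complete

theorem primrecPred_nodup : PrimrecPred fun l : List β => l.Nodup := by
  classical
  have hmem : PrimrecRel fun (l : List β) (b : β) => ∃ a ∈ l, a = b :=
    PrimrecRel.exists_mem_list Primrec.eq
  have h : Primrec fun l : List β =>
      (List.rec true (fun b l ih => !(decide (∃ a ∈ l, a = b)) && ih) l : Bool) := by
    refine Primrec.list_rec (f := fun l : List β => l) (g := fun _ => true)
      (h := fun _ (x : β × List β × Bool) => !(decide (∃ a ∈ x.2.1, a = x.1)) && x.2.2)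
      Primrec.id (Primrec.const true) ?_
    refine Primrec.and.comp (Primrec.not.comp ?_)
      (Primrec.snd.comp (Primrec.snd.comp Primrec.snd))
    exact hmem.decide.comp (Primrec.fst.comp (Primrec.snd.comp Primrec.snd))
      (Primrec.fst.comp Primrec.snd)
  refine PrimrecPred.of_eq (p := fun l => (List.rec true
    (fun b l ih => !(decide (∃ a ∈ l, a = b)) && ih) l : Bool) = true)
    (Primrec.eq.comp h (Primrec.const true)) fun l => ?_
  induction l with
  | nil => simp
  | cons b l ih =>
    simp only [Bool.and_eq_true, ih, List.nodup_cons]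
    simp

end Semidecidable

/-! ### Pairs, binary expansions and counting of strings. -/

section Coding

theorem primrec_pair : Primrec₂ pair := by
  unfold pair
  have h1 : Primrec fun a : BitString × BitString => List.replicate a.1.length true :=
    (Primrec.list_map Primrec.fst (Primrec.const true).to₂).of_eq fun a => by simp
  exact Primrec.list_append.comp h1 (Primrec.list_cons.comp (Primrec.const false)
    (Primrec.list_append.comp Primrec.fst Primrec.snd))

/-- The first component of a pair. -/
def pairFst (s : BitString) : BitString :=
  ((s.dropWhile id).tail).take (s.takeWhile id).length

/-- The second component of a pair. -/
def pairSnd (s : BitString) : BitString :=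
  ((s.dropWhile id).tail).drop (s.takeWhile id).length

theorem primrec_pairFst : Primrec pairFst :=
  Primrec.list_take.comp (Primrec.list_length.comp (Primrec.list_takeWhile Primrec.id))
    (Primrec.list_tail.comp (Primrec.list_dropWhile Primrec.id))

theorem primrec_pairSnd : Primrec pairSnd :=
  Primrec.list_drop.comp (Primrec.list_length.comp (Primrec.list_takeWhile Primrec.id))
    (Primrec.list_tail.comp (Primrec.list_dropWhile Primrec.id))

theorem takeWhile_pair (x y : BitString) : ((pair x y).takeWhile id).length = x.length := by
  rw [pair, List.takeWhile_append_of_pos (by simp)]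
  simp

theorem tail_dropWhile_pair (x y : BitString) : ((pair x y).dropWhile id).tail = x ++ y := by
  rw [pair, List.dropWhile_append_of_pos (by simp)]
  simp

@[simp] theorem pairFst_pair (x y : BitString) : pairFst (pair x y) = x := by
  rw [pairFst, takeWhile_pair, tail_dropWhile_pair]
  simp

@[simp] theorem pairSnd_pair (x y : BitString) : pairSnd (pair x y) = y := by
  rw [pairSnd, takeWhile_pair, tail_dropWhile_pair]
  simp

@[simp] theorem length_pair (x y : BitString) :
    (pair x y).length = 2 * x.length + y.length + 1 := by
  simp [pair]
  omega

/-- The number with a given binary expansion, least significant digit first. -/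
def val : BitString → ℕ
  | [] => 0
  | b :: l => b.toNat + 2 * val l

/-- The `n` lowest binary digits of a number. -/
def digits : ℕ → ℕ → BitString
  | 0, _ => []
  | n + 1, k => decide (k % 2 = 1) :: digits n (k / 2)

@[simp] theorem length_digits (n k : ℕ) : (digits n k).length = n := by
  induction n generalizing k with
  | zero => rfl
  | succ n ih => simp [digits, ih]

theorem val_digits {n k : ℕ} (h : k < 2 ^ n) : val (digits n k) = k := by
  induction n generalizing k with
  | zero =>
    have : k = 0 := by simpa using h
    simp [digits, val, this]
  | succ n ih =>
    have h2 : k / 2 < 2 ^ n := by rw [pow_succ] at h; omega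
    simp only [digits, val, ih h2]
    rcases Nat.mod_two_eq_zero_or_one k with h3 | h3 <;> simp [h3] <;> omega

theorem digits_val (l : BitString) : digits l.length (val l) = l := by
  induction l with
  | nil => rfl
  | cons b l ih =>
    have h1 : (b.toNat + 2 * val l) / 2 = val l := by cases b <;> simp <;> omega
    have h2 : (b.toNat + 2 * val l) % 2 = b.toNat := by cases b <;> simp
    simp only [digits, val, List.length_cons, h1, h2, ih]
    cases b <;> simp

theorem val_lt (l : BitString) : val l < 2 ^ l.length := by
  induction l with
  | nil => simp [val]
  | cons b l ih =>
    simp only [val, List.length_cons, pow_succ]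
    have : b.toNat ≤ 1 := Bool.toNat_le b
    omega

theorem eq_of_val_eq {x y : BitString} (hl : x.length = y.length) (h : val x = val y) :
    x = y := by
  rw [← digits_val x, ← digits_val y, hl, h]

theorem primrec_val : Primrec val := by
  have h : Primrec fun l : BitString =>
      l.foldr (fun b n => (bif b then 1 else 0) + 2 * n) 0 := by
    refine Primrec.list_foldr (f := fun l : BitString => l) (g := fun _ => 0)
      (h := fun _ (x : Bool × ℕ) => (bif x.1 then 1 else 0) + 2 * x.2)
      Primrec.id (Primrec.const 0) ?_
    exact Primrec.nat_add.comp
      (Primrec.cond (Primrec.fst.comp Primrec.snd) (Primrec.const 1) (Primrec.const 0))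
      (Primrec.nat_mul.comp (Primrec.const 2) (Primrec.snd.comp Primrec.snd))
  refine h.of_eq fun l => ?_
  induction l with
  | nil => rfl
  | cons b l ih =>
    simp only [List.foldr_cons, ih, val]
    cases b <;> rfl

/-- A number has a binary expansion of logarithmic length. -/
theorem exists_val_eq (k : ℕ) : ∃ v : BitString, val v = k ∧ v.length ≤ Nat.log 2 k + 1 :=
  ⟨digits (Nat.log 2 k + 1) k, val_digits (Nat.lt_pow_succ_log_self (by norm_num) k), by simp⟩

/-- All strings of length `n`. -/
def strings (n : ℕ) : Finset BitString :=
  (Finset.range (2 ^ n)).image (digits n)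

theorem mem_strings {n : ℕ} {x : BitString} : x ∈ strings n ↔ x.length = n := by
  simp only [strings, Finset.mem_image, Finset.mem_range]
  constructor
  · rintro ⟨k, -, rfl⟩
    simp
  · rintro rfl
    exact ⟨val x, val_lt x, digits_val x⟩

theorem card_strings (n : ℕ) : (strings n).card = 2 ^ n := by
  rw [strings, Finset.card_image_of_injOn, Finset.card_range]
  intro a ha b hb h
  simp only [Finset.coe_range, Set.mem_Iio] at ha hb
  rw [← val_digits ha, ← val_digits hb, h]

theorem card_lt_of_length_le {s : Finset BitString} {l : ℕ} (h : ∀ x ∈ s, x.length ≤ l) :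
    s.card < 2 ^ (l + 1) := by
  have h1 : s ⊆ (Finset.range (l + 1)).biUnion strings := fun x hx => by
    simp only [Finset.mem_biUnion, Finset.mem_range, mem_strings]
    exact ⟨_, Nat.lt_succ_of_le (h x hx), rfl⟩
  have h2 : ∀ m, ∑ i ∈ Finset.range m, 2 ^ i < 2 ^ m := fun m => by
    induction m with
    | zero => simp
    | succ m ih => rw [Finset.sum_range_succ, pow_succ]; omega
  calc s.card ≤ _ := Finset.card_le_card h1
    _ ≤ ∑ i ∈ Finset.range (l + 1), (strings i).card := Finset.card_biUnion_le
    _ = ∑ i ∈ Finset.range (l + 1), 2 ^ i := by simp [card_strings]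
    _ < 2 ^ (l + 1) := h2 _

end Coding

/-! ### Upper bounds from description modes and lower bounds by counting. -/

section Complexity

variable {D : BitString → BitString →. BitString}

theorem condC_le {p x y : BitString} (h : x ∈ D p y) : condC D x y ≤ p.length :=
  Nat.sInf_le ⟨p, h, rfl⟩

/-- A description mode costs twice the length of its first argument plus the length of the
second. -/
theorem IsOptimal.condC_le_of_semi (hD : IsOptimal D)
    {W : BitString → BitString → BitString → BitString → Prop}
    (hW : Semi fun a : (BitString × BitString × BitString) × BitString =>
      W a.1.1 a.1.2.1 a.1.2.2 a.2) :
    ∃ c : ℕ, ∀ v m y x, W v m y x → (∀ x', W v m y x' → x' = x) →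
      condC D x y ≤ 2 * v.length + m.length + c := by
  obtain ⟨f, hf, h1, h2⟩ := Semi.exists_partrec
    (p := fun (a : BitString × BitString × BitString) x => W a.1 a.2.1 a.2.2 x) hW
  -- The program is `pair v m`, whose code spends two bits per bit of v. The mode outputs the first
  -- value it finds; uniqueness of x makes this value x.
  obtain ⟨c, hc⟩ := hD.2 (fun p y => f (pairFst p, pairSnd p, y)) (by
    refine Partrec.comp hf (Primrec.to_comp ?_)
    exact Primrec.pair (primrec_pairFst.comp Primrec.fst)
      (Primrec.pair (primrec_pairSnd.comp Primrec.fst) Primrec.snd))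
  refine ⟨c + 1, fun v m y x hx hu => ?_⟩
  obtain ⟨x', hx'⟩ := h2 (v, m, y) ⟨x, hx⟩
  obtain rfl := hu _ (h1 _ _ hx')
  obtain ⟨p, hp, hl⟩ := hc (pair v m) x' y (by simpa using hx')
  have := condC_le hp
  simp only [length_pair] at hl
  omega

theorem IsOptimal.exists_program (hD : IsOptimal D) (x y : BitString) :
    ∃ p, x ∈ D p y ∧ p.length = condC D x y := by
  obtain ⟨c, hc⟩ := hD.2 (fun p _ => Part.some p) (by
    exact Computable.partrec (f := fun a : BitString × BitString => a.1) Computable.fst)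
  obtain ⟨p, hp, -⟩ := hc x x y (by simp)
  exact Nat.sInf_mem (s := {l : ℕ | ∃ p : BitString, x ∈ D p y ∧ p.length = l}) ⟨_, p, hp, rfl⟩

theorem IsOptimal.card_lt (hD : IsOptimal D) {y : BitString} {l : ℕ} {s : Finset BitString}
    (hs : ∀ x ∈ s, condC D x y ≤ l) : s.card < 2 ^ (l + 1) := by
  choose f hf hl using fun x => hD.exists_program x y
  rw [← Finset.card_image_of_injOn (f := f) (s := s)]
  · refine card_lt_of_length_le fun p hp => ?_
    obtain ⟨x, hx, rfl⟩ := Finset.mem_image.1 hp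
    rw [hl]
    exact hs x hx
  · intro a _ b _ h
    have h1 := hf a
    have h2 := hf b
    rw [← h] at h2
    exact Part.mem_unique h1 h2

/-- Every nonempty finite set has an element whose complexity is about the logarithm of the
cardinality. -/
theorem IsOptimal.exists_condC_ge (hD : IsOptimal D) (y : BitString) {l : ℕ}
    {s : Finset BitString} (hs : 2 ^ l ≤ s.card) : ∃ x ∈ s, l ≤ condC D x y := by
  by_contra! h
  have hs0 : s.Nonempty := Finset.card_pos.1 (lt_of_lt_of_le (by positivity) hs)
  obtain ⟨x, hx⟩ := hs0
  have hl : 0 < l := lt_of_le_of_lt (Nat.zero_le _) (h x hx)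
  have := hD.card_lt (l := l - 1) (s := s) (y := y) fun x hx => by have := h x hx; omega
  rw [Nat.sub_add_cancel hl] at this
  omega

end Complexity

/-! ### Enumeration without repetitions. -/

section Enumeration

variable {α β : Type*} [DecidableEq β]

/-- The list of the distinct values of a partial sequence before a given index. -/
def distinctValues (e : ℕ → Option β) : ℕ → List β
  | 0 => []
  | n + 1 => match e n with
    | none => distinctValues e n
    | some x => if x ∈ distinctValues e n then distinctValues e n else distinctValues e n ++ [x]

theorem distinctValues_prefix (e : ℕ → Option β) {m n : ℕ} (h : m ≤ n) :
    distinctValues e m <+: distinctValues e n := by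
  induction n, h using Nat.le_induction with
  | base => exact List.prefix_rfl
  | succ n _ ih =>
    refine ih.trans ?_
    rw [distinctValues]
    split
    · exact List.prefix_rfl
    · split_ifs
      · exact List.prefix_rfl
      · exact List.prefix_append _ _

theorem nodup_distinctValues (e : ℕ → Option β) (n : ℕ) : (distinctValues e n).Nodup := by
  induction n with
  | zero => simp [distinctValues]
  | succ n ih =>
    rw [distinctValues]
    split
    · exact ih
    · split_ifs with h
      · exact ih
      · rw [List.nodup_append]
        refine ⟨ih, by simp, fun a ha b hb => ?_⟩
        simp only [List.mem_singleton] at hb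
        rintro rfl
        exact h (hb ▸ ha)

theorem mem_distinctValues {e : ℕ → Option β} {n : ℕ} {x : β} :
    x ∈ distinctValues e n ↔ ∃ i < n, e i = some x := by
  induction n with
  | zero => simp [distinctValues]
  | succ n ih =>
    rw [distinctValues]
    simp only [Nat.lt_succ_iff_lt_or_eq, or_and_right, exists_or, exists_eq_left, ← ih]
    split
    · simp_all
    · rename_i y hy
      rw [hy]
      split_ifs with h
      · constructor
        · exact Or.inl
        · rintro (h1 | h1)
          · exact h1
          · exact (Option.some.inj h1) ▸ h
      · simp [eq_comm]

theorem primrec_distinctValues [Primcodable α] [Primcodable β] {e : α → ℕ → Option β} (he : Primrec₂ e) :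
    Primrec₂ fun a n => distinctValues (e a) n := by
  have hmem : PrimrecRel fun (l : List β) (b : β) => ∃ a ∈ l, a = b :=
    PrimrecRel.exists_mem_list Primrec.eq
  classical
  have h : Primrec₂ fun (a : α) (n : ℕ) => (Nat.rec [] (fun n l => Option.casesOn (e a n) l
      fun x => if ∃ b ∈ l, b = x then l else l ++ [x]) n : List β) := by
    refine Primrec.nat_rec (f := fun _ : α => ([] : List β)) (g := fun a (x : ℕ × List β) =>
      Option.casesOn (e a x.1) x.2 fun y => if ∃ b ∈ x.2, b = y then x.2 else x.2 ++ [y])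
      (Primrec.const []) ?_
    refine Primrec.option_casesOn (he.comp Primrec.fst (Primrec.fst.comp Primrec.snd))
      (Primrec.snd.comp Primrec.snd) ?_
    have hl : Primrec fun a : (α × ℕ × List β) × β => a.1.2.2 :=
      Primrec.snd.comp (Primrec.snd.comp Primrec.fst)
    exact Primrec.ite (hmem.comp hl Primrec.snd) hl (Primrec.list_concat.comp hl Primrec.snd)
  refine h.of_eq fun a n => ?_
  induction n with
  | zero => rfl
  | succ n ih =>
    simp only [distinctValues, ← ih]
    cases e a n <;> simp

end Enumeration

/-! ### Description by the number in an enumeration. -/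

section Complexity

variable {D : BitString → BitString →. BitString}

/-- An element of a uniformly enumerable finite set is determined by its number in the
enumeration. -/
theorem IsOptimal.condC_le_log_card (hD : IsOptimal D)
    {W : BitString → BitString → BitString → Prop}
    (hW : Semi fun a : (BitString × BitString) × BitString => W a.1.1 a.1.2 a.2) :
    ∃ c : ℕ, ∀ v y x M, W v y x →
      (∀ s : Finset BitString, (∀ x' ∈ s, W v y x') → s.card ≤ M) →
      condC D x y ≤ 2 * v.length + Nat.log 2 M + c := by
  classical
  obtain ⟨R, hR, hRW⟩ := hW
  set e : BitString × BitString → ℕ → Option BitString := fun a n =>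
    (Encodable.decode (α := BitString × ℕ) n).bind
      fun b => if R (a, b.1) b.2 then some b.1 else none with he
  have he' : Primrec₂ e := by
    refine Primrec.option_bind (Primrec.decode.comp Primrec.snd) ?_
    exact Primrec.ite (hR.comp
      (Primrec.pair (Primrec.fst.comp Primrec.fst) (Primrec.fst.comp Primrec.snd))
      (Primrec.snd.comp Primrec.snd))
      (Primrec.option_some.comp (Primrec.fst.comp Primrec.snd)) (Primrec.const _)
  have heW : ∀ v y x, W v y x ↔ ∃ n, e (v, y) n = some x := fun v y x => by
    refine (hRW ((v, y), x)).trans ?_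
    constructor
    · rintro ⟨t, ht⟩
      exact ⟨Encodable.encode (x, t), by simp [he, ht]⟩
    · rintro ⟨n, hn⟩
      obtain ⟨⟨b', t⟩, -, h2⟩ := Option.bind_eq_some_iff.1 hn
      by_cases h : R ((v, y), b') t
      · simp only [h, if_true, Option.some.injEq] at h2
        exact ⟨t, h2 ▸ h⟩
      · simp [h] at h2
  -- The description mode needs only the position of x in the enumeration; the bound M is never
  -- given to it, it only bounds the position.
  obtain ⟨c, hc⟩ := hD.condC_le_of_semi
    (W := fun v m y x => ∃ t, (distinctValues (e (v, y)) t)[val m]? = some x) (by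
    refine Semi.exists (Semi.of_primrec (Primrec.eq.comp
      (Primrec.list_getElem?.comp ((primrec_distinctValues he').comp ?_ Primrec.snd) ?_) ?_))
    · exact Primrec.pair (Primrec.fst.comp (Primrec.fst.comp Primrec.fst))
        (Primrec.snd.comp (Primrec.snd.comp (Primrec.fst.comp Primrec.fst)))
    · exact primrec_val.comp (Primrec.fst.comp (Primrec.snd.comp (Primrec.fst.comp Primrec.fst)))
    · exact Primrec.option_some.comp (Primrec.snd.comp Primrec.fst))
  refine ⟨c + 1, fun v y x M hx hM => ?_⟩
  obtain ⟨n, hn⟩ := (heW v y x).1 hx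
  have hmem : x ∈ distinctValues (e (v, y)) (n + 1) :=
    mem_distinctValues.2 ⟨n, Nat.lt_succ_self n, hn⟩
  obtain ⟨k, hk⟩ := List.mem_iff_getElem?.1 hmem
  have hkM : k < M := by
    have h1 := hM (distinctValues (e (v, y)) (n + 1)).toFinset fun x' hx' => by
      obtain ⟨i, -, hi⟩ := mem_distinctValues.1 (List.mem_toFinset.1 hx')
      exact (heW v y x').2 ⟨i, hi⟩
    rw [List.toFinset_card_of_nodup (nodup_distinctValues _ _)] at h1
    exact lt_of_lt_of_le (List.getElem?_eq_some_iff.1 hk).1 h1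
  obtain ⟨m, hm, hml⟩ := exists_val_eq k
  have h3 := hc v m y x ⟨n + 1, by rw [hm, hk]⟩ (by
    rintro x' ⟨t, ht⟩
    rw [hm] at ht
    -- The lists at different stages are prefixes of one another, so the entry at position k never
    -- changes once it exists.
    have h4 : ∀ {t t' x x'}, t ≤ t' → (distinctValues (e (v, y)) t)[k]? = some x →
        (distinctValues (e (v, y)) t')[k]? = some x' → x' = x := by
      intro t t' x x' h ht ht'
      obtain ⟨r, hr⟩ := distinctValues_prefix (e (v, y)) h
      rw [← hr, List.getElem?_append_left (List.getElem?_eq_some_iff.1 ht).1, ht] at ht'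
      exact (Option.some.inj ht').symm
    rcases le_total t (n + 1) with h | h
    · exact (h4 h ht hk).symm
    · exact h4 h hk ht)
  have := Nat.log_mono_right (b := 2) hkM.le
  omega

end Complexity

/-! ### Basic inequalities, the chain rule and symmetry of information. -/

section Inequalities

variable {D : BitString → BitString →. BitString}

theorem IsOptimal.semi_mem (hD : IsOptimal D) {α : Type*} [Primcodable α]
    {p y x : α → BitString} (hp : Primrec p) (hy : Primrec y) (hx : Primrec x) :
    Semi fun a => x a ∈ D (p a) (y a) :=
  (semi_graph (f := fun a : BitString × BitString => D a.1 a.2) hD.1).comp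
    (f := fun a => ((p a, y a), x a)) ((hp.pair hy).pair hx)

theorem IsOptimal.condC_le_length (hD : IsOptimal D) :
    ∃ c : ℕ, ∀ x y, condC D x y ≤ x.length + c := by
  obtain ⟨c, hc⟩ := hD.condC_le_of_semi (W := fun _ m _ x => x = m)
    (Semi.of_primrec (Primrec.eq.comp Primrec.snd
      (Primrec.fst.comp (Primrec.snd.comp Primrec.fst))))
  exact ⟨c, fun x y => by simpa using hc [] x y x rfl fun _ h => h⟩

theorem IsOptimal.condC_apply_le (hD : IsOptimal D) {f : BitString → BitString}
    (hf : Primrec f) : ∃ c : ℕ, ∀ y, condC D (f y) y ≤ c := by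
  obtain ⟨c, hc⟩ := hD.condC_le_of_semi (W := fun _ _ y x => x = f y)
    (Semi.of_primrec (Primrec.eq.comp Primrec.snd
      (hf.comp (Primrec.snd.comp (Primrec.snd.comp Primrec.fst)))))
  exact ⟨c, fun y => by simpa using hc [] [] y (f y) rfl fun _ h => h⟩

/-- Two programs are composed. Doubling one of them makes the concatenation decodable at constant
cost, and either may be doubled; in applications it is the one that is logarithmically short. -/
theorem IsOptimal.exists_condC_trans (hD : IsOptimal D) :
    ∃ c : ℕ, ∀ a b y, condC D b y ≤ condC D a y + 2 * condC D b a + c ∧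
      condC D b y ≤ 2 * condC D a y + condC D b a + c := by
  obtain ⟨c, hc⟩ := hD.condC_le_of_semi (W := fun v m y b => ∃ a, a ∈ D m y ∧ b ∈ D v a) (by
    have h : Primrec fun t : ((BitString × BitString × BitString) × BitString) × BitString =>
        t.1.1 := Primrec.fst.comp Primrec.fst
    exact Semi.exists (Semi.and
      (hD.semi_mem (Primrec.fst.comp (Primrec.snd.comp h)) (Primrec.snd.comp (Primrec.snd.comp h))
        Primrec.snd)
      (hD.semi_mem (Primrec.fst.comp h) Primrec.snd (Primrec.snd.comp Primrec.fst))))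
  obtain ⟨c', hc'⟩ := hD.condC_le_of_semi (W := fun v m y b => ∃ a, a ∈ D v y ∧ b ∈ D m a) (by
    have h : Primrec fun t : ((BitString × BitString × BitString) × BitString) × BitString =>
        t.1.1 := Primrec.fst.comp Primrec.fst
    exact Semi.exists (Semi.and
      (hD.semi_mem (Primrec.fst.comp h) (Primrec.snd.comp (Primrec.snd.comp h)) Primrec.snd)
      (hD.semi_mem (Primrec.fst.comp (Primrec.snd.comp h)) Primrec.snd
        (Primrec.snd.comp Primrec.fst))))
  refine ⟨c + c', fun a b y => ?_⟩
  obtain ⟨p, hp, hpl⟩ := hD.exists_program a y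
  obtain ⟨r, hr, hrl⟩ := hD.exists_program b a
  have hu : ∀ b', (∃ a', a' ∈ D p y ∧ b' ∈ D r a') → b' = b := by
    rintro b' ⟨a', h1, h2⟩
    obtain rfl := Part.mem_unique h1 hp
    exact Part.mem_unique h2 hr
  have h1 := hc r p y b ⟨a, hp, hr⟩ hu
  have h2 := hc' p r y b ⟨a, hp, hr⟩ hu
  constructor <;> omega

theorem IsOptimal.exists_condC_pair_le (hD : IsOptimal D) :
    ∃ c : ℕ, ∀ a b y, condC D (pair a b) y ≤ 2 * condC D a y + condC D b y + c := by
  obtain ⟨c, hc⟩ := hD.condC_le_of_semi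
    (W := fun v m y x => ∃ a : BitString × BitString, (x = pair a.1 a.2 ∧ a.1 ∈ D v y) ∧
      a.2 ∈ D m y) (by
    have h : Primrec fun t : ((BitString × BitString × BitString) × BitString) ×
        BitString × BitString => t.1.1 := Primrec.fst.comp Primrec.fst
    have hy := Primrec.snd.comp (Primrec.snd.comp h)
    exact Semi.exists (Semi.and (Semi.and
      (Semi.of_primrec (Primrec.eq.comp (Primrec.snd.comp Primrec.fst)
        (primrec_pair.comp (Primrec.fst.comp Primrec.snd) (Primrec.snd.comp Primrec.snd))))
      (hD.semi_mem (Primrec.fst.comp h) hy (Primrec.fst.comp Primrec.snd)))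
      (hD.semi_mem (Primrec.fst.comp (Primrec.snd.comp h)) hy (Primrec.snd.comp Primrec.snd))))
  refine ⟨c, fun a b y => ?_⟩
  obtain ⟨p, hp, hpl⟩ := hD.exists_program a y
  obtain ⟨r, hr, hrl⟩ := hD.exists_program b y
  have h1 := hc p r y (pair a b) ⟨(a, b), ⟨rfl, hp⟩, hr⟩ (by
    rintro x' ⟨⟨a', b'⟩, ⟨rfl, h2⟩, h3⟩
    rw [Part.mem_unique h2 hp, Part.mem_unique h3 hr])
  omega

theorem IsOptimal.condC_le_plainC (hD : IsOptimal D) :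
    ∃ c : ℕ, ∀ x y, condC D x y ≤ plainC D x + c := by
  obtain ⟨c₁, h₁⟩ := hD.exists_condC_trans
  obtain ⟨c₂, h₂⟩ := hD.condC_apply_le (Primrec.const [])
  refine ⟨2 * c₂ + c₁, fun x y => ?_⟩
  have := (h₁ [] x y).2
  have := h₂ y
  unfold plainC
  omega

theorem log_le_of_le_mul {m n j : ℕ} (h : m ≤ 2 ^ j * n) (hn : n ≠ 0) :
    Nat.log 2 m ≤ Nat.log 2 n + j := by
  refine (Nat.log_mono_right h).trans ?_
  clear h
  induction j with
  | zero => simp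
  | succ j ih =>
    rw [pow_succ, mul_comm (2 ^ j) 2, mul_assoc, mul_comm 2,
      Nat.log_mul_base (by norm_num) (by positivity)]
    omega

theorem one_le_log (N : ℕ) : 1 ≤ Nat.log 2 (N + 2) :=
  Nat.log_pos (by norm_num) (by omega)

theorem log_add_le {m N c : ℕ} (h : m ≤ 2 * N + c) :
    Nat.log 2 m ≤ Nat.log 2 (N + 2) + (c + 1) := by
  refine log_le_of_le_mul ?_ (by omega)
  have h1 : c < 2 ^ c := Nat.lt_two_pow_self
  rw [pow_succ]
  nlinarith

/-- The hard direction of the Kolmogorov–Levin chain rule. -/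
theorem IsOptimal.exists_chain_rule (hD : IsOptimal D) :
    ∃ c : ℕ, ∀ a b t N, a.length + b.length ≤ N →
      condC D a t + condC D b (pair a t) ≤ condC D (pair a b) t + c * Nat.log 2 (N + 2) := by
  classical
  -- First mode: b is found by its number in the section over a of the set of pairs with programs of
  -- length at most m.
  obtain ⟨c₁, h₁⟩ := hD.condC_le_log_card
    (W := fun v y b => ∃ p : BitString, p.length ≤ val v ∧
      pair (pairFst y) b ∈ D p (pairSnd y)) (by
    have hy : Primrec fun t : ((BitString × BitString) × BitString) × BitString => t.1.1.2 :=
      Primrec.snd.comp (Primrec.fst.comp Primrec.fst)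
    exact Semi.exists (Semi.and
      (Semi.of_primrec (Primrec.nat_le.comp (Primrec.list_length.comp Primrec.snd)
        (primrec_val.comp (Primrec.fst.comp (Primrec.fst.comp Primrec.fst)))))
      (hD.semi_mem Primrec.snd (primrec_pairSnd.comp hy)
        (primrec_pair.comp (primrec_pairFst.comp hy) (Primrec.snd.comp Primrec.fst)))))
  -- Second mode: a is found by its number among the strings whose section has at least 2^k
  -- elements. A list of 2^k distinct elements certifies this, which keeps the condition
  -- semidecidable.
  obtain ⟨c₂, h₂⟩ := hD.condC_le_log_card
    (W := fun v y a => ∃ L : List BitString, (L.Nodup ∧ L.length = 2 ^ val (pairSnd v)) ∧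
      ∀ b ∈ L, ∃ p : BitString, p.length ≤ val (pairFst v) ∧ pair a b ∈ D p y) (by
    refine Semi.exists (Semi.and (Semi.of_primrec (PrimrecPred.and
      (primrecPred_nodup.comp Primrec.snd) (Primrec.eq.comp
        (Primrec.list_length.comp Primrec.snd) ?_))) ?_)
    · exact (Primrec₂.unpaired'.1 Nat.Primrec.pow).comp (Primrec.const 2) (primrec_val.comp
        (primrec_pairSnd.comp (Primrec.fst.comp (Primrec.fst.comp Primrec.fst))))
    · refine (Semi.forall_mem (p := fun b (a : (BitString × BitString) × BitString) =>
        ∃ p : BitString, p.length ≤ val (pairFst a.1.1) ∧ pair a.2 b ∈ D p a.1.2) ?_).comp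
        (f := fun x : ((BitString × BitString) × BitString) × List BitString => (x.2, x.1))
        (Primrec.snd.pair Primrec.fst)
      have ha : Primrec fun t : (BitString × (BitString × BitString) × BitString) × BitString =>
        t.1.2 := Primrec.snd.comp Primrec.fst
      exact Semi.exists (Semi.and
        (Semi.of_primrec (Primrec.nat_le.comp (Primrec.list_length.comp Primrec.snd)
          (primrec_val.comp (primrec_pairFst.comp (Primrec.fst.comp (Primrec.fst.comp ha))))))
        (hD.semi_mem Primrec.snd (Primrec.snd.comp (Primrec.fst.comp ha))
          (primrec_pair.comp (Primrec.snd.comp ha) (Primrec.fst.comp Primrec.fst)))))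
  obtain ⟨c₃, h₃⟩ := hD.condC_le_length
  refine ⟨8 * (c₃ + 3) + c₁ + c₂ + 20, fun a b t N hN => ?_⟩
  set m := condC D (pair a b) t with hm
  set ℓ := Nat.log 2 (N + 2) with hℓ
  have hℓ1 : 1 ≤ ℓ := one_le_log N
  have hmN : Nat.log 2 m ≤ ℓ + (c₃ + 2) := by
    refine log_add_le ?_
    have := h₃ (pair a b) t
    rw [length_pair] at this
    omega
  obtain ⟨v, hv, hvl⟩ := exists_val_eq m
  have hA : ∀ a' b', (∃ p : BitString, p.length ≤ m ∧ pair a' b' ∈ D p t) →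
      condC D (pair a' b') t ≤ m := fun a' b' ⟨p, hp, h⟩ => (condC_le h).trans hp
  have hpairs : ∀ S : Finset (BitString × BitString),
      (∀ x ∈ S, ∃ p : BitString, p.length ≤ m ∧ pair x.1 x.2 ∈ D p t) →
      S.card < 2 ^ (m + 1) := fun S hS => by
    rw [← Finset.card_image_of_injOn (f := fun x : BitString × BitString => pair x.1 x.2)]
    · refine hD.card_lt (y := t) fun x hx => ?_
      obtain ⟨y, hy, rfl⟩ := Finset.mem_image.1 hx
      exact hA _ _ (hS y hy)
    · intro x _ y _ h
      have h1 := congrArg pairFst h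
      have h2 := congrArg pairSnd h
      simp only [pairFst_pair, pairSnd_pair] at h1 h2
      exact Prod.ext h1 h2
  have hfiber : ∀ s : Finset BitString,
      (∀ b' ∈ s, ∃ p : BitString, p.length ≤ m ∧ pair a b' ∈ D p t) →
      s.card < 2 ^ (m + 1) := fun s hs => by
    rw [← Finset.card_image_of_injective s (Prod.mk_right_injective a)]
    refine hpairs _ fun x hx => ?_
    obtain ⟨y, hy, rfl⟩ := Finset.mem_image.1 hx
    exact hs y hy
  have hfin : {b' | ∃ p : BitString, p.length ≤ m ∧ pair a b' ∈ D p t}.Finite := by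
    by_contra h
    obtain ⟨s, hs, hc⟩ := Set.Infinite.exists_subset_card_eq h (2 ^ (m + 1))
    exact (hfiber s fun b' hb' => hs hb').ne hc
  set A := hfin.toFinset with hAdef
  have hbA : b ∈ A := by
    obtain ⟨p, hp, hpl⟩ := hD.exists_program (pair a b) t
    exact hfin.mem_toFinset.2 ⟨p, hpl.le, hp⟩
  have hAcard : A.card < 2 ^ (m + 1) := hfiber A fun b' hb' => hfin.mem_toFinset.1 hb'
  set k := Nat.log 2 A.card with hk
  have hkA : 2 ^ k ≤ A.card := Nat.pow_log_le_self 2 (Finset.card_pos.2 ⟨b, hbA⟩).ne'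
  have hkm : k < m + 1 := by
    by_contra! h
    have := Nat.pow_le_pow_right (n := 2) (by norm_num) h
    omega
  have hb : condC D b (pair a t) ≤ 2 * v.length + k + c₁ := by
    refine h₁ v (pair a t) b A.card ?_ ?_
    · simp only [pairFst_pair, pairSnd_pair, hv]
      exact hfin.mem_toFinset.1 hbA
    · intro s hs
      simp only [pairFst_pair, pairSnd_pair, hv] at hs
      exact Finset.card_le_card fun b' hb' => hfin.mem_toFinset.2 (hs b' hb')
  obtain ⟨v', hv', hvl'⟩ := exists_val_eq k
  have ha : condC D a t ≤ 2 * (pair v v').length + Nat.log 2 (2 ^ (m + 1 - k)) + c₂ := by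
    refine h₂ (pair v v') t a _ ?_ ?_
    · obtain ⟨B, hBA, hB⟩ := Finset.exists_subset_card_eq hkA
      refine ⟨B.toList, ⟨B.nodup_toList, ?_⟩, fun b' hb' => ?_⟩
      · simp [hv', hB]
      · simp only [pairFst_pair, hv]
        exact hfin.mem_toFinset.1 (hBA (Finset.mem_toList.1 hb'))
    -- Double counting: there are fewer than 2^(m+1) pairs and each counted section contributes 2^k
    -- of them. The bounds k for b and m + 1 - k for a add up to m + 1.
    · intro s hs
      simp only [pairFst_pair, pairSnd_pair, hv, hv'] at hs
      choose! L hL hLp using hs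
      have h4 := hpairs ((s.sigma fun a' => (L a').toFinset).map
        (Equiv.sigmaEquivProd BitString BitString).toEmbedding) fun x hx => by
          obtain ⟨⟨x1, x2⟩, hy, rfl⟩ := Finset.mem_map.1 hx
          obtain ⟨hy1, hy2⟩ := Finset.mem_sigma.1 hy
          exact hLp x1 hy1 x2 (List.mem_toFinset.1 hy2)
      rw [Finset.card_map, Finset.card_sigma, Finset.sum_congr rfl fun a' ha' => by
        rw [List.toFinset_card_of_nodup (hL a' ha').1, (hL a' ha').2], Finset.sum_const,
        smul_eq_mul, ← Nat.sub_add_cancel hkm.le, pow_add] at h4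
      exact (Nat.lt_of_mul_lt_mul_right h4).le
  rw [Nat.log_pow (by norm_num), length_pair] at ha
  have hlog : Nat.log 2 k ≤ Nat.log 2 m := Nat.log_mono_right (by omega)
  have h5 : condC D a t + condC D b (pair a t)
      ≤ m + 1 + (6 * (v.length) + 2 * v'.length + 2) + c₁ + c₂ := by omega
  have h6 : (8 * (c₃ + 3) + c₁ + c₂ + 20) * ℓ
      = 20 * ℓ + (8 * (c₃ + 3) + c₁ + c₂) * ℓ := by ring
  have h7 : (8 * (c₃ + 3) + c₁ + c₂) ≤ (8 * (c₃ + 3) + c₁ + c₂) * ℓ :=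
    Nat.le_mul_of_pos_right _ hℓ1
  omega

/-- Here both programs may be long, so neither is doubled: they are concatenated, and the length of
the first is supplied separately for O(log N) bits. -/
theorem IsOptimal.exists_plainC_pair_le (hD : IsOptimal D) :
    ∃ c : ℕ, ∀ a b N, b.length ≤ N →
      plainC D (pair a b) ≤ plainC D b + condC D a b + c * Nat.log 2 (N + 2) := by
  obtain ⟨c, hc⟩ := hD.condC_le_of_semi
    (W := fun v m _ x => ∃ a : BitString × BitString, (x = pair a.1 a.2 ∧
      a.2 ∈ D (m.take (val v)) []) ∧ a.1 ∈ D (m.drop (val v)) a.2) (by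
    have hv : Primrec fun t : ((BitString × BitString × BitString) × BitString) ×
        BitString × BitString => val t.1.1.1 :=
      primrec_val.comp (Primrec.fst.comp (Primrec.fst.comp Primrec.fst))
    have hm : Primrec fun t : ((BitString × BitString × BitString) × BitString) ×
        BitString × BitString => t.1.1.2.1 :=
      Primrec.fst.comp (Primrec.snd.comp (Primrec.fst.comp Primrec.fst))
    exact Semi.exists (Semi.and (Semi.and
      (Semi.of_primrec (Primrec.eq.comp (Primrec.snd.comp Primrec.fst)
        (primrec_pair.comp (Primrec.fst.comp Primrec.snd) (Primrec.snd.comp Primrec.snd))))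
      (hD.semi_mem (Primrec.list_take.comp hv hm) (Primrec.const []) (Primrec.snd.comp Primrec.snd)))
      (hD.semi_mem (Primrec.list_drop.comp hv hm) (Primrec.snd.comp Primrec.snd)
        (Primrec.fst.comp Primrec.snd))))
  obtain ⟨c', hc'⟩ := hD.condC_le_length
  refine ⟨2 * (c' + 3) + c + 2, fun a b N hN => ?_⟩
  obtain ⟨p, hp, hpl⟩ := hD.exists_program b []
  obtain ⟨r, hr, hrl⟩ := hD.exists_program a b
  obtain ⟨v, hv, hvl⟩ := exists_val_eq p.length
  have h1 := hc v (p ++ r) [] (pair a b) ⟨(a, b), ⟨rfl, by simpa [hv] using hp⟩,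
    by simpa [hv] using hr⟩ (by
    rintro x' ⟨⟨a', b'⟩, ⟨rfl, h2⟩, h3⟩
    simp only [hv, List.take_left, List.drop_left] at h2 h3
    obtain rfl := Part.mem_unique h2 hp
    rw [Part.mem_unique h3 hr])
  have h2 := hc' b []
  have h3 : Nat.log 2 p.length ≤ Nat.log 2 (N + 2) + (c' + 1) := log_add_le (by omega)
  have h4 := one_le_log N
  have h5 : (2 * (c' + 3) + c + 2) * Nat.log 2 (N + 2)
      = 2 * Nat.log 2 (N + 2) + (2 * (c' + 3) + c) * Nat.log 2 (N + 2) := by ring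
  have h6 : (2 * (c' + 3) + c) ≤ (2 * (c' + 3) + c) * Nat.log 2 (N + 2) :=
    Nat.le_mul_of_pos_right _ h4
  simp only [List.length_append] at h1
  unfold plainC
  omega

/-- Symmetry of information. -/
theorem IsOptimal.exists_symmetry (hD : IsOptimal D) :
    ∃ c : ℕ, ∀ a b N, a.length + b.length ≤ N →
      plainC D a + condC D b a ≤ plainC D b + condC D a b + c * Nat.log 2 (N + 2) := by
  obtain ⟨c₁, h₁⟩ := hD.exists_chain_rule
  obtain ⟨c₂, h₂⟩ := hD.exists_plainC_pair_le
  obtain ⟨c₃, h₃⟩ := hD.exists_condC_trans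
  obtain ⟨c₄, h₄⟩ := hD.condC_apply_le (f := fun y => pair y [])
    (primrec_pair.comp Primrec.id (Primrec.const []))
  refine ⟨c₁ + c₂ + c₃ + 2 * c₄, fun a b N hN => ?_⟩
  have k₁ := h₁ a b [] N hN
  have k₂ := h₂ a b N (by omega)
  have k₃ := (h₃ (pair a []) b a).2
  have k₄ := h₄ a
  have h5 : c₃ + 2 * c₄ ≤ (c₃ + 2 * c₄) * Nat.log 2 (N + 2) :=
    Nat.le_mul_of_pos_right _ (one_le_log N)
  have h6 : (c₁ + c₂ + c₃ + 2 * c₄) * Nat.log 2 (N + 2) = c₁ * Nat.log 2 (N + 2)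
    + c₂ * Nat.log 2 (N + 2) + (c₃ + 2 * c₄) * Nat.log 2 (N + 2) := by ring
  unfold plainC at *
  omega

end Inequalities

/-! ### Lines in the plane over a prime field, and their counting. -/

section Lines

theorem primrecPred_prime : PrimrecPred Nat.Prime := by
  have h : PrimrecRel fun n y : ℕ => ∀ x < n, x < 2 ∨ ¬ y % x = 0 := by
    refine PrimrecRel.forall_lt (R := fun x y => x < 2 ∨ ¬ y % x = 0) (PrimrecPred.or ?_ ?_)
    · exact Primrec.nat_lt.comp Primrec.fst (Primrec.const 2)
    · exact PrimrecPred.not (Primrec.eq.comp (Primrec.nat_mod.comp Primrec.snd Primrec.fst)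
        (Primrec.const 0))
  refine ((Primrec.nat_le.comp (Primrec.const 2) Primrec.id).and
    (h.comp Primrec.id Primrec.id)).of_eq fun n => ?_
  rw [Nat.prime_def_lt']
  refine and_congr Iff.rfl (forall_congr' fun m => ?_)
  simp only [id, Nat.dvd_iff_mod_eq_zero]
  constructor
  · intro h h2 h3
    exact (h h3).resolve_left (by omega)
  · intro h h3
    by_cases h2 : 2 ≤ m
    · exact Or.inr (h h2 h3)
    · exact Or.inl (by omega)

/-- The largest prime that does not exceed `2 ^ n`. -/
def modulus (n : ℕ) : ℕ := Nat.findGreatest Nat.Prime (2 ^ n)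

/-- Needed so that incidence of points and lines is decidable from n alone: no bits are spent on
describing the field. -/
theorem primrec_modulus : Primrec modulus := by
  refine Primrec.nat_findGreatest (f := fun n => 2 ^ n) (p := fun _ m => Nat.Prime m)
    ((Primrec₂.unpaired'.1 Nat.Primrec.pow).comp (Primrec.const 2) Primrec.id)
    (primrecPred_prime.comp Primrec.snd)

theorem modulus_le (n : ℕ) : modulus n ≤ 2 ^ n := Nat.findGreatest_le _

theorem exists_prime_le_two_pow {n : ℕ} (hn : 1 ≤ n) :
    ∃ p, p.Prime ∧ 2 ^ n < 2 * p ∧ p ≤ 2 ^ n := by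
  obtain ⟨p, hp, h1, h2⟩ := Nat.exists_prime_lt_and_le_two_mul (2 ^ (n - 1)) (by positivity)
  obtain ⟨m, rfl⟩ := Nat.exists_eq_add_of_le' hn
  simp only [Nat.add_sub_cancel] at h1 h2
  exact ⟨p, hp, by rw [pow_succ]; omega, by rw [pow_succ]; omega⟩

theorem modulus_prime {n : ℕ} (hn : 1 ≤ n) : (modulus n).Prime := by
  obtain ⟨p, hp, -, h⟩ := exists_prime_le_two_pow hn
  exact Nat.findGreatest_spec h hp

theorem lt_two_mul_modulus {n : ℕ} (hn : 1 ≤ n) : 2 ^ n < 2 * modulus n := by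
  obtain ⟨p, hp, h1, h⟩ := exists_prime_le_two_pow hn
  have : p ≤ modulus n := Nat.le_findGreatest h hp
  omega

/-- The slope of the line coded by a string. -/
def slope (n : ℕ) (z : BitString) : ℕ := val (z.take n)

/-- The intercept of the line coded by a string. -/
def intercept (n : ℕ) (z : BitString) : ℕ := val ((z.drop n).take n)

/-- The point `(u, w)` lies on the line coded by `z`. -/
def OnLine (n : ℕ) (z u w : BitString) : Prop :=
  ((u.length = n ∧ w.length = n) ∧ val u < modulus n) ∧
    ((0 < slope n z ∧ slope n z < modulus n) ∧ intercept n z < modulus n) ∧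
    (slope n z * val u + intercept n z) % modulus n = val w

theorem primrecPred_onLine {α : Type*} [Primcodable α] {n : α → ℕ} {z u w : α → BitString}
    (hn : Primrec n) (hz : Primrec z) (hu : Primrec u) (hw : Primrec w) :
    PrimrecPred fun a => OnLine (n a) (z a) (u a) (w a) := by
  have hs : Primrec fun a => slope (n a) (z a) := primrec_val.comp (Primrec.list_take.comp hn hz)
  have hi : Primrec fun a => intercept (n a) (z a) :=
    primrec_val.comp (Primrec.list_take.comp hn (Primrec.list_drop.comp hn hz))
  have hq : Primrec fun a => modulus (n a) := primrec_modulus.comp hn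
  have hvu := primrec_val.comp hu
  exact (((Primrec.eq.comp (Primrec.list_length.comp hu) hn).and
    (Primrec.eq.comp (Primrec.list_length.comp hw) hn)).and (Primrec.nat_lt.comp hvu hq)).and
    ((((Primrec.nat_lt.comp (Primrec.const 0) hs).and (Primrec.nat_lt.comp hs hq)).and
      (Primrec.nat_lt.comp hi hq)).and (Primrec.eq.comp (Primrec.nat_mod.comp
        (Primrec.nat_add.comp (Primrec.nat_mul.comp hs hvu) hi) hq) (primrec_val.comp hw)))

theorem OnLine.cast_eq {n : ℕ} {z u w : BitString} (h : OnLine n z u w) :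
    (slope n z : ZMod (modulus n)) * (val u : ZMod (modulus n)) + intercept n z = val w := by
  rw [← h.2.2, ZMod.natCast_mod]
  push_cast
  rfl

theorem OnLine.right_unique {n : ℕ} {z u w w' : BitString} (h : OnLine n z u w)
    (h' : OnLine n z u w') : w' = w :=
  eq_of_val_eq (h'.1.1.2.trans h.1.1.2.symm) (h'.2.2.symm.trans h.2.2)

theorem eq_of_cast_eq {q a b : ℕ} (ha : a < q) (hb : b < q) (h : (a : ZMod q) = b) : a = b := by
  have := (ZMod.natCast_eq_natCast_iff' a b q).1 h
  rwa [Nat.mod_eq_of_lt ha, Nat.mod_eq_of_lt hb] at this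

/-- The slope is invertible modulo the prime. Excluding slope zero is what makes the roles of the
two coordinates symmetric. -/
theorem OnLine.left_unique {n : ℕ} (hn : 1 ≤ n) {z u u' w : BitString} (h : OnLine n z u w)
    (h' : OnLine n z u' w) : u' = u := by
  have : Fact (modulus n).Prime := ⟨modulus_prime hn⟩
  refine eq_of_val_eq (h'.1.1.1.trans h.1.1.1.symm) (eq_of_cast_eq h'.1.2 h.1.2 ?_)
  have h0 : (slope n z : ZMod (modulus n)) ≠ 0 := fun h0 =>
    h.2.1.1.1.ne' (eq_of_cast_eq h.2.1.1.2 (modulus_prime hn).pos (by simpa using h0))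
  have := h.cast_eq.trans h'.cast_eq.symm
  exact (mul_left_cancel₀ h0 (add_right_cancel this)).symm

/-- Two distinct points determine the line. -/
theorem OnLine.line_unique {n : ℕ} (hn : 1 ≤ n) {z z' u w u' w' : BitString}
    (h₁ : OnLine n z u w) (h₂ : OnLine n z u' w') (h₁' : OnLine n z' u w)
    (h₂' : OnLine n z' u' w') (hne : u' ≠ u) (hl : n + n ≤ z.length) (hl' : n + n ≤ z'.length)
    (hd : z.drop (n + n) = z'.drop (n + n)) : z = z' := by
  have : Fact (modulus n).Prime := ⟨modulus_prime hn⟩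
  have hu : (val u' : ZMod (modulus n)) - val u ≠ 0 := fun h =>
    hne (eq_of_val_eq (h₂.1.1.1.trans h₁.1.1.1.symm)
      (eq_of_cast_eq h₂.1.2 h₁.1.2 (sub_eq_zero.1 h)))
  have e₁ := h₁.cast_eq.trans h₁'.cast_eq.symm
  have e₂ := h₂.cast_eq.trans h₂'.cast_eq.symm
  have hs : (slope n z : ZMod (modulus n)) = slope n z' := by
    refine mul_right_cancel₀ hu ?_
    linear_combination e₂ - e₁
  have hi : (intercept n z : ZMod (modulus n)) = intercept n z' := by
    linear_combination e₁ - val u * hs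
  have hs' := eq_of_cast_eq h₁.2.1.1.2 h₁'.2.1.1.2 hs
  have hi' := eq_of_cast_eq h₁.2.1.2 h₁'.2.1.2 hi
  have t₁ : z.take n = z'.take n := eq_of_val_eq (by simp; omega) hs'
  have t₂ : (z.drop n).take n = (z'.drop n).take n := eq_of_val_eq (by simp; omega) hi'
  have t₃ : (z.drop n).drop n = (z'.drop n).drop n := by simpa [List.drop_drop] using hd
  rw [← List.take_append_drop n z, ← List.take_append_drop n z', t₁,
    ← List.take_append_drop n (z.drop n), ← List.take_append_drop n (z'.drop n), t₂, t₃]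

open Classical in
/-- The strings of length `n + n + r` that code a line through a given point. -/
noncomputable def linesThrough (n r : ℕ) (u w : BitString) : Finset BitString :=
  (strings (n + n + r)).filter fun z => OnLine n z u w

theorem mem_linesThrough {n r : ℕ} {u w z : BitString} :
    z ∈ linesThrough n r u w ↔ z.length = n + n + r ∧ OnLine n z u w := by
  simp [linesThrough, mem_strings]

/-- Every nonzero slope extends to a unique line through the point, and the last r bits are free. -/
theorem le_card_linesThrough {n : ℕ} (hn : 1 ≤ n) (r : ℕ) {u w : BitString} (hu : u.length = n)
    (hw : w.length = n) (huq : val u < modulus n) (hwq : val w < modulus n) :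
    (modulus n - 1) * 2 ^ r ≤ (linesThrough n r u w).card := by
  have : Fact (modulus n).Prime := ⟨modulus_prime hn⟩
  have hq := modulus_le n
  -- The intercept forced by slope a.
  set b : ℕ → ℕ := fun a => ((val w : ZMod (modulus n)) - a * val u).val with hb
  have hbq : ∀ a, b a < modulus n := fun a => ZMod.val_lt _
  set f : ℕ × BitString → BitString := fun x => digits n x.1 ++ (digits n (b x.1) ++ x.2) with hf
  have hslope : ∀ x : ℕ × BitString, x.1 < modulus n → slope n (f x) = x.1 := fun x hx => by
    rw [slope, hf, List.take_left' (length_digits _ _), val_digits (hx.trans_le hq)]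
  have hinter : ∀ x : ℕ × BitString, intercept n (f x) = b x.1 := fun x => by
    rw [intercept, hf, List.drop_left' (length_digits _ _), List.take_left' (length_digits _ _),
      val_digits ((hbq _).trans_le hq)]
  have hrest : ∀ x : ℕ × BitString, (f x).drop (n + n) = x.2 := fun x => by
    rw [← List.drop_drop, hf, List.drop_left' (length_digits _ _),
      List.drop_left' (length_digits _ _)]
  have hcard : (modulus n - 1) * 2 ^ r
      = ((Finset.Ico 1 (modulus n)) ×ˢ strings r).card := by
    rw [Finset.card_product, card_strings, Nat.card_Ico]
  rw [hcard]
  refine Finset.card_le_card_of_injOn f ?_ ?_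
  · intro x hx
    simp only [Finset.coe_product, Set.mem_prod, Finset.coe_Ico, Set.mem_Ico, Finset.mem_coe,
      mem_strings] at hx
    simp only [Finset.mem_coe, mem_linesThrough]
    refine ⟨by simp [hf, hx.2]; omega, ⟨⟨hu, hw⟩, huq⟩, ⟨⟨?_, ?_⟩, ?_⟩, ?_⟩
    · rw [hslope x hx.1.2]; omega
    · rw [hslope x hx.1.2]; exact hx.1.2
    · rw [hinter]; exact hbq _
    · rw [hslope x hx.1.2, hinter]
      refine eq_of_cast_eq (Nat.mod_lt _ (modulus_prime hn).pos) hwq ?_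
      rw [ZMod.natCast_mod]
      push_cast
      rw [hb, ZMod.natCast_zmod_val]
      ring
  · intro x hx y hy hxy
    simp only [Finset.coe_product, Set.mem_prod, Finset.coe_Ico, Set.mem_Ico] at hx hy
    refine Prod.ext ?_ ?_
    · rw [← hslope x hx.1.2, ← hslope y hy.1.2, hxy]
    · rw [← hrest x, ← hrest y, hxy]

/-- Few lines through a given point meet the graph of a function in many other points. -/
theorem card_mul_le_of_many_points {n r M : ℕ} (hn : 1 ≤ n) {u w : BitString}
    {h : BitString → BitString → Prop} (hh : ∀ w' u₁ u₂, h w' u₁ → h w' u₂ → u₁ = u₂)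
    {B : Finset BitString} (hB : ∀ z ∈ B, (z.length = n + n + r ∧ OnLine n z u w) ∧
      ∃ F : Finset BitString, F.card = M ∧
        ∀ u' ∈ F, u' ≠ u ∧ ∃ w', OnLine n z u' w' ∧ h w' u') :
    B.card * M ≤ 2 ^ (n + r) := by
  classical
  choose! hz F hF hFp using hB
  choose! hne w' hw' hhw using hFp
  have h1 : (B.sigma F).card = B.card * M := by
    rw [Finset.card_sigma, Finset.sum_congr rfl fun z hz => hF z hz, Finset.sum_const,
      smul_eq_mul]
  have h2 : (strings n ×ˢ strings r).card = 2 ^ (n + r) := by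
    rw [Finset.card_product, card_strings, card_strings, pow_add]
  rw [← h1, ← h2]
  -- A pair (z, u') is sent to w' and the last r bits of z. It can be recovered: w' gives u' because
  -- h is single-valued in this direction, and the points (u, w) and (u', w') then give the line.
  refine Finset.card_le_card_of_injOn
    (fun x : (_ : BitString) × BitString => (w' x.1 x.2, x.1.drop (n + n))) ?_ ?_
  · rintro ⟨z, u'⟩ hx
    obtain ⟨hzB, huF⟩ := Finset.mem_sigma.1 hx
    simp only [Finset.coe_product, Set.mem_prod, Finset.mem_coe, mem_strings]
    refine ⟨(hw' z hzB u' huF).1.1.2, ?_⟩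
    have := (hz z hzB).1
    rw [List.length_drop]
    omega
  · rintro ⟨z₁, u₁⟩ hx₁ ⟨z₂, u₂⟩ hx₂ heq
    obtain ⟨hzB₁, huF₁⟩ := Finset.mem_sigma.1 hx₁
    obtain ⟨hzB₂, huF₂⟩ := Finset.mem_sigma.1 hx₂
    simp only [Prod.mk.injEq] at heq
    have k₁ := hhw z₁ hzB₁ u₁ huF₁
    have k₂ := hhw z₂ hzB₂ u₂ huF₂
    rw [heq.1] at k₁
    obtain rfl : u₁ = u₂ := hh _ _ _ k₁ k₂
    have e₁ := hw' z₁ hzB₁ u₁ huF₁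
    rw [heq.1] at e₁
    have l₁ := (hz z₁ hzB₁).1
    have l₂ := (hz z₂ hzB₂).1
    obtain rfl : z₁ = z₂ := OnLine.line_unique hn (hz z₁ hzB₁).2 e₁ (hz z₂ hzB₂).2
      (hw' z₂ hzB₂ u₁ huF₂) (hne z₁ hzB₁ u₁ huF₁) (by omega) (by omega) heq.2
    rfl

end Lines

/-! ### Residues as substitutes for strings of complexity about n. -/

section LineComplexity

variable {D : BitString → BitString →. BitString}

/-- On a given line each coordinate of a point determines the other one. -/
theorem IsOptimal.exists_condC_onLine_le (hD : IsOptimal D) :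
    ∃ c : ℕ, ∀ n N z u w, 1 ≤ n → n ≤ N → OnLine n z u w →
      condC D w (pair u z) ≤ c * Nat.log 2 (N + 2) ∧
      condC D u (pair w z) ≤ c * Nat.log 2 (N + 2) := by
  have hv : Primrec fun a : (BitString × BitString × BitString) × BitString => val a.1.1 :=
    primrec_val.comp (Primrec.fst.comp Primrec.fst)
  have hy : Primrec fun a : (BitString × BitString × BitString) × BitString => a.1.2.2 :=
    Primrec.snd.comp (Primrec.snd.comp Primrec.fst)
  obtain ⟨c₁, h₁⟩ := hD.condC_le_of_semi
    (W := fun v _ y x => OnLine (val v) (pairSnd y) (pairFst y) x) (Semi.of_primrec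
      (primrecPred_onLine hv (primrec_pairSnd.comp hy) (primrec_pairFst.comp hy) Primrec.snd))
  obtain ⟨c₂, h₂⟩ := hD.condC_le_of_semi
    (W := fun v _ y x => OnLine (val v) (pairSnd y) x (pairFst y)) (Semi.of_primrec
      (primrecPred_onLine hv (primrec_pairSnd.comp hy) Primrec.snd (primrec_pairFst.comp hy)))
  refine ⟨c₁ + c₂ + 4, fun n N z u w hn hN h => ?_⟩
  obtain ⟨v, hv, hvl⟩ := exists_val_eq n
  have k₁ := h₁ v [] (pair u z) w (by simpa [hv] using h) fun x' hx' =>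
    h.right_unique (by simpa [hv] using hx')
  have k₂ := h₂ v [] (pair w z) u (by simpa [hv] using h) fun x' hx' =>
    h.left_unique hn (by simpa [hv] using hx')
  have k₃ : Nat.log 2 n ≤ Nat.log 2 (N + 2) := Nat.log_mono_right (by omega)
  have k₄ := one_le_log N
  have k₅ : (c₁ + c₂ + 4) * Nat.log 2 (N + 2)
      = 4 * Nat.log 2 (N + 2) + (c₁ + c₂) * Nat.log 2 (N + 2) := by ring
  have k₆ : (c₁ + c₂) ≤ (c₁ + c₂) * Nat.log 2 (N + 2) := Nat.le_mul_of_pos_right _ k₄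
  simp only [List.length_nil] at k₁ k₂
  constructor <;> omega

/-- The string `u` is a residue modulo the chosen prime of `n` digits
that contains the same information as `x` up to `e` bits. -/
def IsFingerprint (D : BitString → BitString →. BitString) (e n : ℕ) (x u : BitString) : Prop :=
  (u.length = n ∧ val u < modulus n) ∧ condC D x u ≤ e ∧ condC D u x ≤ e

/-- Take a shortest program of x, read it as a number and reduce it modulo the prime. The quotient
is below 2^(e+1), where n + e bounds the complexity of x, so it and the lengths suffice to restore
the program from the residue. -/
theorem IsOptimal.exists_isFingerprint (hD : IsOptimal D) (c₀ : ℕ) :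
    ∃ c : ℕ, ∀ x n N, 1 ≤ n → n ≤ N → x.length ≤ N →
      plainC D x ≤ n + c₀ * Nat.log 2 (N + 2) →
      ∃ u, IsFingerprint D (c * Nat.log 2 (N + 2)) n x u := by
  -- Shortest programs need not be unique; f selects one effectively from x and its complexity, so
  -- that the residue becomes computable from x.
  obtain ⟨f, hf, hf₁, hf₂⟩ := Semi.exists_partrec
    (p := fun (a : ℕ × BitString) p => p.length = a.1 ∧ a.2 ∈ D p [])
    (Semi.and (Semi.of_primrec (Primrec.eq.comp (Primrec.list_length.comp Primrec.snd)
      (Primrec.fst.comp Primrec.fst)))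
      (hD.semi_mem Primrec.snd (Primrec.const []) (Primrec.snd.comp Primrec.fst)))
  obtain ⟨c₁, h₁⟩ := hD.condC_le_of_semi
    (W := fun v m y x => ∃ p : BitString, (p.length = val (pairSnd v) ∧
      val p = val y + modulus (val (pairFst v)) * val m) ∧ x ∈ D p []) (by
    have ht : Primrec fun t : ((BitString × BitString × BitString) × BitString) × BitString =>
      t.1.1 := Primrec.fst.comp Primrec.fst
    refine Semi.exists (Semi.and (Semi.of_primrec (PrimrecPred.and ?_ ?_))
      (hD.semi_mem Primrec.snd (Primrec.const []) (Primrec.snd.comp Primrec.fst)))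
    · exact Primrec.eq.comp (Primrec.list_length.comp Primrec.snd)
        (primrec_val.comp (primrec_pairSnd.comp (Primrec.fst.comp ht)))
    · exact Primrec.eq.comp (primrec_val.comp Primrec.snd) (Primrec.nat_add.comp
        (primrec_val.comp (Primrec.snd.comp (Primrec.snd.comp ht)))
        (Primrec.nat_mul.comp (primrec_modulus.comp (primrec_val.comp (primrec_pairFst.comp
          (Primrec.fst.comp ht)))) (primrec_val.comp (Primrec.fst.comp (Primrec.snd.comp ht))))))
  obtain ⟨c₂, h₂⟩ := hD.condC_le_of_semi
    (W := fun v _ x u => ∃ p : BitString, (u.length = val (pairFst v) ∧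
      val u = val p % modulus (val (pairFst v))) ∧ p ∈ f (val (pairSnd v), x)) (by
    have ht : Primrec fun t : ((BitString × BitString × BitString) × BitString) × BitString =>
      t.1.1 := Primrec.fst.comp Primrec.fst
    have hn := primrec_val.comp (primrec_pairFst.comp (Primrec.fst.comp ht))
    have hu : Primrec fun t : ((BitString × BitString × BitString) × BitString) × BitString =>
      t.1.2 := Primrec.snd.comp Primrec.fst
    refine Semi.exists (Semi.and (Semi.of_primrec (PrimrecPred.and
      (Primrec.eq.comp (Primrec.list_length.comp hu) hn) (Primrec.eq.comp (primrec_val.comp hu)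
        (Primrec.nat_mod.comp (primrec_val.comp Primrec.snd) (primrec_modulus.comp hn))))) ?_)
    exact (semi_graph hf).comp (f := fun t : ((BitString × BitString × BitString) × BitString) ×
      BitString => ((val (pairSnd t.1.1.1), t.1.1.2.2), t.2))
      (((primrec_val.comp (primrec_pairSnd.comp (Primrec.fst.comp ht))).pair
        (Primrec.snd.comp (Primrec.snd.comp ht))).pair Primrec.snd))
  obtain ⟨c₃, h₃⟩ := hD.condC_le_length
  refine ⟨2 * (c₃ + 10) + c₁ + c₂ + c₀ + 20, fun x n N hn hnN hxN hx => ?_⟩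
  set ℓ := Nat.log 2 (N + 2) with hℓ
  have hℓ1 : 1 ≤ ℓ := one_le_log N
  set e := c₀ * ℓ with he
  obtain ⟨p₀, hp₀, hp₀l⟩ := hD.exists_program x []
  obtain ⟨p, hp⟩ := hf₂ (plainC D x, x) ⟨p₀, hp₀l, hp₀⟩
  obtain ⟨hpl, hpx⟩ := hf₁ _ _ hp
  simp only at hpl hpx
  set q := modulus n with hq
  have hq0 : 0 < q := (modulus_prime hn).pos
  have huq : val p % q < q := Nat.mod_lt _ hq0
  have hval : val (digits n (val p % q)) = val p % q := val_digits (huq.trans_le (modulus_le n))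
  -- By the choice of the prime 2^n < 2q, which costs the extra bit in e + 1.
  have hs : val p / q < 2 ^ (e + 1) := by
    rw [Nat.div_lt_iff_lt_mul hq0]
    calc val p < 2 ^ p.length := val_lt p
      _ ≤ 2 ^ (n + e) := Nat.pow_le_pow_right (by norm_num) (by omega)
      _ = 2 ^ e * 2 ^ n := by rw [pow_add, mul_comm]
      _ ≤ 2 ^ e * (2 * q) := Nat.mul_le_mul_left _ (lt_two_mul_modulus hn).le
      _ = 2 ^ (e + 1) * q := by rw [pow_succ]; ring
  obtain ⟨v, hv, hvl⟩ := exists_val_eq n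
  obtain ⟨v', hv', hvl'⟩ := exists_val_eq (plainC D x)
  have k₁ := h₁ (pair v v') (digits (e + 1) (val p / q)) (digits n (val p % q)) x
    ⟨p, ⟨by simp [hv', hpl], by simp [hv, ← hq, hval, val_digits hs, Nat.mod_add_div]⟩, hpx⟩ (by
    rintro x' ⟨p', ⟨h4, h5⟩, h6⟩
    simp only [pairFst_pair, pairSnd_pair, hv, hv', ← hq, hval, val_digits hs,
      Nat.mod_add_div] at h4 h5
    obtain rfl : p' = p := eq_of_val_eq (h4.trans hpl.symm) h5
    exact Part.mem_unique h6 hpx)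
  have k₂ := h₂ (pair v v') [] x (digits n (val p % q))
    ⟨p, ⟨by simp [hv], by simp [hv, ← hq, hval]⟩, by simpa [hv'] using hp⟩ (by
    rintro u ⟨p', ⟨h4, h5⟩, h6⟩
    simp only [pairFst_pair, pairSnd_pair, hv, hv', ← hq] at h4 h5 h6
    obtain rfl : p' = p := Part.mem_unique h6 hp
    exact eq_of_val_eq (by simp [h4]) (h5.trans hval.symm))
  have k₃ := h₃ x []
  have k₄ : Nat.log 2 (plainC D x) ≤ ℓ + (c₃ + 1) := log_add_le (by unfold plainC; omega)
  have k₅ : Nat.log 2 n ≤ ℓ := Nat.log_mono_right (by omega)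
  have k₆ : (2 * (c₃ + 10) + c₁ + c₂ + c₀ + 20) * ℓ
      = 20 * ℓ + e + (2 * (c₃ + 10) + c₁ + c₂) * ℓ := by rw [he]; ring
  have k₇ : (2 * (c₃ + 10) + c₁ + c₂) ≤ (2 * (c₃ + 10) + c₁ + c₂) * ℓ :=
    Nat.le_mul_of_pos_right _ hℓ1
  simp only [length_pair, length_digits, List.length_nil] at k₁ k₂
  refine ⟨digits n (val p % q), ⟨length_digits _ _, ?_⟩, ?_, ?_⟩
  · rw [hval]; exact huq
  · omega
  · omega

end LineComplexity

theorem approxEq_natCast {c N a b : ℕ} :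
    ApproxEq c N a b ↔ a ≤ b + c * Nat.log 2 (N + 2) ∧ b ≤ a + c * Nat.log 2 (N + 2) := by
  rw [ApproxEq, abs_le]
  constructor
  · rintro ⟨h1, h2⟩
    constructor <;> zify <;> linarith
  · rintro ⟨h1, h2⟩
    zify at h1 h2
    constructor <;> linarith

theorem approxEq_sub_zero {c N a b : ℕ} :
    ApproxEq c N ((a : ℤ) - b) 0 ↔ ApproxEq c N a b := by
  rw [ApproxEq, ApproxEq, sub_zero]

theorem mul_log_mono {c N N' : ℕ} (h : N ≤ N') :
    c * Nat.log 2 (N + 2) ≤ c * Nat.log 2 (N' + 2) :=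
  Nat.mul_le_mul_left _ (Nat.log_mono_right (by omega))

theorem le_mul_log (c N : ℕ) : c ≤ c * Nat.log 2 (N + 2) :=
  Nat.le_mul_of_pos_right _ (one_le_log N)

/-! ### The random line z and its independence of x and of y. -/

section Witness

variable {D : BitString → BitString →. BitString}

/-- A line in general position through the point formed by fingerprints of `x` and `y`. -/
def IsWitness (D : BitString → BitString →. BitString) (c n r : ℕ) (x y z : BitString) : Prop :=
  ∃ u w, IsFingerprint D (c * Nat.log 2 (x.length + y.length + z.length + 2)) n x u ∧
    IsFingerprint D (c * Nat.log 2 (x.length + y.length + z.length + 2)) n y w ∧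
    (z.length = n + n + r ∧ OnLine n z u w) ∧ n + r ≤ condC D z (pair x y) + 1

/-- A set of at least 2^l strings has an element of complexity at least l under any condition; this
is applied to the lines through the point of fingerprints, under the condition (x, y). -/
theorem IsOptimal.exists_isWitness (hD : IsOptimal D) (c₀ : ℕ) :
    ∃ c : ℕ, ∀ n r x y, 1 ≤ n →
      plainC D x ≤ n + c₀ * Nat.log 2 (x.length + y.length + 2) →
      plainC D y ≤ n + c₀ * Nat.log 2 (x.length + y.length + 2) →
      ∃ z, IsWitness D c n r x y z := by
  obtain ⟨c, hc⟩ := hD.exists_isFingerprint c₀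
  refine ⟨c, fun n r x y hn hx hy => ?_⟩
  have hN := mul_log_mono (c := c₀)
    (show x.length + y.length ≤ x.length + y.length + (n + n + r) by omega)
  obtain ⟨u, hu⟩ := hc x n (x.length + y.length + (n + n + r)) hn (by omega) (by omega)
    (by omega)
  obtain ⟨w, hw⟩ := hc y n (x.length + y.length + (n + n + r)) hn (by omega) (by omega)
    (by omega)
  have hq := lt_two_mul_modulus hn
  have hcard := le_card_linesThrough hn r hu.1.1 hw.1.1 hu.1.2 hw.1.2
  -- The prime exceeds 2^(n-1), so there are at least 2^(n-1) nonzero slopes. This is the source of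
  -- the + 1 in `IsWitness`.
  have h2 : 2 ^ (n - 1 + r) ≤ (linesThrough n r u w).card := by
    refine le_trans ?_ hcard
    rw [pow_add]
    refine Nat.mul_le_mul_right _ ?_
    obtain ⟨m, rfl⟩ := Nat.exists_eq_add_of_le' hn
    rw [pow_succ] at hq
    simp only [Nat.add_sub_cancel]
    omega
  obtain ⟨z, hz, hzC⟩ := hD.exists_condC_ge (pair x y) h2
  rw [mem_linesThrough] at hz
  refine ⟨z, u, w, ?_, ?_, hz, by omega⟩
  · rw [hz.1]; exact hu
  · rw [hz.1]; exact hw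

theorem IsOptimal.exists_condC_swap_le (hD : IsOptimal D) :
    ∃ c : ℕ, ∀ x y z, condC D z (pair x y) ≤ condC D z (pair y x) + c := by
  obtain ⟨c₁, h₁⟩ := hD.exists_condC_trans
  obtain ⟨c₂, h₂⟩ := hD.condC_apply_le (f := fun s => pair (pairSnd s) (pairFst s))
    (primrec_pair.comp primrec_pairSnd primrec_pairFst)
  refine ⟨c₁ + 2 * c₂, fun x y z => ?_⟩
  have k₁ := (h₁ (pair y x) z (pair x y)).2
  have k₂ := h₂ (pair x y)
  simp only [pairFst_pair, pairSnd_pair] at k₂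
  omega

/-- If `z` together with `u`, obtained from `x`, determines `w`, equivalent to `y`, then `z`
has given `x` at least as much complexity as `y` has given `x` and `z` has given both. -/
theorem IsOptimal.exists_condC_add_le (hD : IsOptimal D) :
    ∃ c : ℕ, ∀ x y z u w N e, w.length + z.length ≤ N → condC D u x ≤ e → condC D y w ≤ e →
      condC D w y ≤ e → condC D w (pair u z) ≤ e →
      condC D y x + condC D z (pair x y) ≤ condC D z x + 12 * e + c * Nat.log 2 (N + 2) := by
  obtain ⟨c₁, h₁⟩ := hD.exists_condC_trans
  obtain ⟨c₂, h₂⟩ := hD.exists_condC_pair_le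
  obtain ⟨c₃, h₃⟩ := hD.exists_chain_rule
  obtain ⟨c₄, h₄⟩ := hD.condC_apply_le primrec_pairFst
  obtain ⟨c₅, h₅⟩ := hD.condC_apply_le primrec_pairSnd
  refine ⟨c₃ + 12 * c₁ + 12 * c₂ + 12 * c₄ + 12 * c₅, fun x y z u w N e hN hu hyw hwy hw => ?_⟩
  -- The chain rule under condition x is applied to (w, z): the pair costs about C(z|x), because x
  -- gives u and then u and z give w. Elsewhere w is exchanged with y at cost O(e).
  have k₁ := (h₁ w y x).1
  have k₂ := h₃ w z x N hN
  have k₃ := (h₁ (pair w x) z (pair x y)).2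
  have k₄ := h₂ w x (pair x y)
  have k₅ := (h₁ y w (pair x y)).2
  have k₆ := (h₁ (pair u z) (pair w z) x).1
  have k₇ := h₂ w z (pair u z)
  have k₈ := h₂ u z x
  have k₉ := h₄ (pair x y)
  have l₁ := h₅ (pair x y)
  have l₂ := h₅ (pair u z)
  simp only [pairFst_pair, pairSnd_pair] at k₉ l₁ l₂
  have l₃ := le_mul_log (12 * c₁ + 12 * c₂ + 12 * c₄ + 12 * c₅) N
  have l₄ : (c₃ + 12 * c₁ + 12 * c₂ + 12 * c₄ + 12 * c₅) * Nat.log 2 (N + 2)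
    = c₃ * Nat.log 2 (N + 2)
      + (12 * c₁ + 12 * c₂ + 12 * c₄ + 12 * c₅) * Nat.log 2 (N + 2) := by ring
  omega

/-- The n bits of y given x add to the n + r bits of z given both. The second bound exchanges x and
y, since w and z determine u as well. -/
theorem IsOptimal.exists_condC_ge_of_isWitness (hD : IsOptimal D) (c₀ c : ℕ) :
    ∃ c' : ℕ, ∀ n r x y z N, 1 ≤ n → N = x.length + y.length + z.length →
      IsWitness D c n r x y z →
      n ≤ condC D y x + c₀ * Nat.log 2 (N + 2) → n ≤ condC D x y + c₀ * Nat.log 2 (N + 2) →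
      n + n + r ≤ condC D z x + c' * Nat.log 2 (N + 2) ∧
      n + n + r ≤ condC D z y + c' * Nat.log 2 (N + 2) := by
  obtain ⟨c₁, h₁⟩ := hD.exists_condC_add_le
  obtain ⟨c₂, h₂⟩ := hD.exists_condC_onLine_le
  obtain ⟨c₃, h₃⟩ := hD.exists_condC_swap_le
  refine ⟨c₀ + 2 * c₁ + 12 * (c + c₂) + c₃ + 1, ?_⟩
  rintro n r x y z N hn rfl ⟨u, w, hu, hw, ⟨hzl, hz⟩, hC⟩ hyx hxy
  set N := x.length + y.length + z.length with hN
  set ℓ := Nat.log 2 (N + 2) with hℓ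
  obtain ⟨hl₁, hl₂⟩ := h₂ n N z u w hn (by omega) hz
  rw [← hℓ] at hl₁ hl₂
  have hul := hu.1.1
  have hwl := hw.1.1
  have he : (c + c₂) * ℓ = c * ℓ + c₂ * ℓ := by ring
  have ux := hu.2.1
  have xu := hu.2.2
  have wy := hw.2.1
  have yw := hw.2.2
  have e₁ := h₁ x y z u w (N + N) ((c + c₂) * ℓ)
    (by omega) (by omega) (by omega) (by omega) (by omega)
  have e₂ := h₁ y x z w u (N + N) ((c + c₂) * ℓ)
    (by omega) (by omega) (by omega) (by omega) (by omega)
  have e₃ := h₃ x y z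
  have e₄ : Nat.log 2 (N + N + 2) ≤ ℓ + 1 := log_le_of_le_mul (by omega) (by omega)
  have e₅ : c₁ * Nat.log 2 (N + N + 2) ≤ c₁ * ℓ + c₁ :=
    (Nat.mul_le_mul_left _ e₄).trans (by rw [mul_add, mul_one])
  have e₆ := le_mul_log (c₁ + c₃ + 1) N
  have e₇ : (c₀ + 2 * c₁ + 12 * (c + c₂) + c₃ + 1) * ℓ
    = c₀ * ℓ + c₁ * ℓ + 12 * ((c + c₂) * ℓ) + (c₁ + c₃ + 1) * ℓ := by ring
  rw [← hℓ] at e₆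
  constructor <;> omega

end Witness

/-! ### Fixed points on a line: few make u simple, many make the line nonrandom. -/

section FixedPoints

variable {D : BitString → BitString →. BitString}

/-- The program `g` with the data `p` maps some point `w` with `(u, w)` on the line `z`
back to `u`. -/
def IsFixed (D : BitString → BitString →. BitString) (n : ℕ) (g p z u : BitString) : Prop :=
  ∃ w, OnLine n z u w ∧ u ∈ D g (pair p w)

theorem IsOptimal.semi_isFixed (hD : IsOptimal D) {α : Type*} [Primcodable α] {n : α → ℕ}
    {g p z u : α → BitString} (hn : Primrec n) (hg : Primrec g) (hp : Primrec p)
    (hz : Primrec z) (hu : Primrec u) : Semi fun a => IsFixed D (n a) (g a) (p a) (z a) (u a) :=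
  Semi.exists (Semi.and
    (Semi.of_primrec (primrecPred_onLine (hn.comp Primrec.fst) (hz.comp Primrec.fst)
      (hu.comp Primrec.fst) Primrec.snd))
    (hD.semi_mem (hg.comp Primrec.fst) (primrec_pair.comp (hp.comp Primrec.fst) Primrec.snd)
      (hu.comp Primrec.fst)))

/-- If there are few fixed points, then each of them is simple. -/
theorem IsOptimal.exists_condC_fixed_le (hD : IsOptimal D) :
    ∃ c : ℕ, ∀ n k N g p z u, n ≤ N → IsFixed D n g p z u →
      (¬ ∃ F : Finset BitString, F.card = 2 ^ k ∧ ∀ u' ∈ F, u' ≠ u ∧ IsFixed D n g p z u') →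
      condC D u (pair p z) ≤ 2 * g.length + k + c * Nat.log 2 (N + 2) := by
  classical
  obtain ⟨c, hc⟩ := hD.condC_le_log_card
    (W := fun v y u => IsFixed D (val (pairFst v)) (pairSnd v) (pairFst y) (pairSnd y) u) (by
    have hv : Primrec fun a : (BitString × BitString) × BitString => a.1.1 :=
      Primrec.fst.comp Primrec.fst
    have hy : Primrec fun a : (BitString × BitString) × BitString => a.1.2 :=
      Primrec.snd.comp Primrec.fst
    exact hD.semi_isFixed (primrec_val.comp (primrec_pairFst.comp hv)) (primrec_pairSnd.comp hv)
      (primrec_pairFst.comp hy) (primrec_pairSnd.comp hy) Primrec.snd)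
  refine ⟨c + 10, fun n k N g p z u hN hu hF => ?_⟩
  obtain ⟨v, hv, hvl⟩ := exists_val_eq n
  have h := hc (pair v g) (pair p z) u (2 ^ k) (by simpa [hv] using hu) (by
    intro s hs
    simp only [pairFst_pair, pairSnd_pair, hv] at hs
    by_contra! hcard
    have h1 : 2 ^ k ≤ (s.erase u).card := by
      have := Finset.pred_card_le_card_erase (s := s) (a := u)
      omega
    obtain ⟨F, hFs, hFc⟩ := Finset.exists_subset_card_eq h1
    exact hF ⟨F, hFc, fun u' hu' =>
      ⟨Finset.ne_of_mem_erase (hFs hu'), hs _ (Finset.mem_of_mem_erase (hFs hu'))⟩⟩)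
  rw [Nat.log_pow (by norm_num), length_pair] at h
  have h2 : Nat.log 2 n ≤ Nat.log 2 (N + 2) := Nat.log_mono_right (by omega)
  have h3 := le_mul_log (c + 6) N
  have h4 : (c + 10) * Nat.log 2 (N + 2)
    = 4 * Nat.log 2 (N + 2) + (c + 6) * Nat.log 2 (N + 2) := by ring
  omega

/-- If there are many fixed points, then the line is not random relative to the data. -/
theorem IsOptimal.exists_condC_line_add_le (hD : IsOptimal D) :
    ∃ c : ℕ, ∀ n r N g p z u w s t, 1 ≤ n → n ≤ N → r ≤ N →
      z.length = n + n + r → OnLine n z u w →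
      (∃ F : Finset BitString, F.card = 2 ^ (2 ^ s * t) ∧
        ∀ u' ∈ F, u' ≠ u ∧ IsFixed D n g p z u') →
      condC D z (pair p (pair u w)) + 2 ^ s * t
        ≤ n + r + 2 * g.length + 8 * s + 4 * t + c * Nat.log 2 (N + 2) := by
  classical
  -- The line z is described by its number among the strings that code a line through (u, w) with
  -- 2^k other fixed points. The auxiliary string v carries n, r, the threshold exponent k = 2^s * t
  -- and the program g.
  obtain ⟨c, hc⟩ := hD.condC_le_log_card
    (W := fun v y z => ∃ L : List BitString,
      ((z.length = val (pairFst (pairFst v)) + val (pairFst (pairFst v))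
          + val (pairSnd (pairFst v)) ∧
        OnLine (val (pairFst (pairFst v))) z (pairFst (pairSnd y)) (pairSnd (pairSnd y))) ∧
      (L.Nodup ∧ L.length = 2 ^ (2 ^ (pairFst (pairFst (pairSnd v))).length *
        (pairSnd (pairFst (pairSnd v))).length))) ∧
      ∀ u' ∈ L, u' ≠ pairFst (pairSnd y) ∧
        IsFixed D (val (pairFst (pairFst v))) (pairSnd (pairSnd v)) (pairFst y) z u') (by
    have hpow : Primrec fun k : ℕ => 2 ^ k :=
      (Primrec₂.unpaired'.1 Nat.Primrec.pow).comp (Primrec.const 2) Primrec.id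
    have hv : Primrec fun a : (BitString × BitString) × BitString => a.1.1 :=
      Primrec.fst.comp Primrec.fst
    have hy : Primrec fun a : (BitString × BitString) × BitString => a.1.2 :=
      Primrec.snd.comp Primrec.fst
    have hn := primrec_val.comp (primrec_pairFst.comp (primrec_pairFst.comp hv))
    have hr := primrec_val.comp (primrec_pairSnd.comp (primrec_pairFst.comp hv))
    have hst := primrec_pairFst.comp (primrec_pairSnd.comp hv)
    have hu := primrec_pairFst.comp (primrec_pairSnd.comp hy)
    refine Semi.exists (Semi.and (Semi.of_primrec (PrimrecPred.and (PrimrecPred.and ?_ ?_)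
      (PrimrecPred.and (primrecPred_nodup.comp Primrec.snd) ?_))) ?_)
    · exact PrimrecPred.comp (Primrec.eq.comp (Primrec.list_length.comp Primrec.snd)
        (Primrec.nat_add.comp (Primrec.nat_add.comp hn hn) hr)) Primrec.fst
    · exact PrimrecPred.comp (primrecPred_onLine hn Primrec.snd hu
        (primrec_pairSnd.comp (primrec_pairSnd.comp hy))) Primrec.fst
    · have hm := Primrec.nat_mul.comp
        (hpow.comp (Primrec.list_length.comp (primrec_pairFst.comp hst)))
        (Primrec.list_length.comp (primrec_pairSnd.comp hst))
      exact Primrec.eq.comp (Primrec.list_length.comp Primrec.snd)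
        ((hpow.comp hm).comp Primrec.fst)
    · refine (Semi.forall_mem (p := fun u' (a : (BitString × BitString) × BitString) =>
        u' ≠ pairFst (pairSnd a.1.2) ∧ IsFixed D (val (pairFst (pairFst a.1.1)))
          (pairSnd (pairSnd a.1.1)) (pairFst a.1.2) a.2 u') ?_).comp
        (f := fun x : ((BitString × BitString) × BitString) × List BitString => (x.2, x.1))
        (Primrec.snd.pair Primrec.fst)
      refine Semi.and (Semi.of_primrec (PrimrecPred.not
        (Primrec.eq.comp Primrec.fst (hu.comp Primrec.snd)))) ?_
      exact hD.semi_isFixed (hn.comp Primrec.snd)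
        ((primrec_pairSnd.comp (primrec_pairSnd.comp hv)).comp Primrec.snd)
        ((primrec_pairFst.comp hy).comp Primrec.snd) (Primrec.snd.comp Primrec.snd) Primrec.fst)
  refine ⟨c + 50, fun n r N g p z u w s t hn hnN hrN hzl hz ⟨F, hFc, hF⟩ => ?_⟩
  set k := 2 ^ s * t with hk
  obtain ⟨v, hv, hvl⟩ := exists_val_eq n
  obtain ⟨v', hv', hvl'⟩ := exists_val_eq r
  have hfew : ∀ B : Finset BitString, (∀ z ∈ B, (z.length = n + n + r ∧ OnLine n z u w) ∧
      ∃ F : Finset BitString, F.card = 2 ^ k ∧ ∀ u' ∈ F, u' ≠ u ∧ IsFixed D n g p z u') →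
      B.card * 2 ^ k ≤ 2 ^ (n + r) := fun B hB =>
    card_mul_le_of_many_points hn (h := fun w' u' => u' ∈ D g (pair p w'))
      (fun _ _ _ h1 h2 => Part.mem_unique h1 h2) hB
  -- The count for the single line z shows that the truncated subtraction n + r - k is genuine.
  have hkn : k ≤ n + r := by
    have := hfew {z} fun z' hz' => by
      rw [Finset.mem_singleton] at hz'
      exact hz' ▸ ⟨⟨hzl, hz⟩, F, hFc, hF⟩
    rw [Finset.card_singleton, one_mul] at this
    exact (Nat.pow_le_pow_iff_right (by norm_num)).1 this
  -- With s and t in unary, k costs only 8s + 4t bits, whereas the gain is 2^s * t. So t can be log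
  -- N and s a large constant.
  have h := hc (pair (pair v v') (pair (pair (List.replicate s true) (List.replicate t true)) g))
    (pair p (pair u w)) z (2 ^ (n + r - k)) (by
      simp only [pairFst_pair, pairSnd_pair, hv, hv', List.length_replicate, ← hk]
      exact ⟨F.toList, ⟨⟨hzl, hz⟩, F.nodup_toList, by simp [hFc]⟩,
        fun u' hu' => hF u' (Finset.mem_toList.1 hu')⟩) (by
      intro B hB
      simp only [pairFst_pair, pairSnd_pair, hv, hv', List.length_replicate, ← hk] at hB
      have h1 := hfew B fun z' hz' => by
        obtain ⟨L, ⟨h3, h4, h5⟩, h6⟩ := hB z' hz'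
        refine ⟨h3, L.toFinset, by rw [List.toFinset_card_of_nodup h4, h5],
          fun u' hu' => h6 u' (List.mem_toFinset.1 hu')⟩
      rw [← Nat.sub_add_cancel hkn, pow_add] at h1
      exact Nat.le_of_mul_le_mul_right h1 (by positivity))
  simp only [Nat.log_pow (b := 2) (by norm_num), length_pair, List.length_replicate] at h
  have h2 : Nat.log 2 n ≤ Nat.log 2 (N + 2) := Nat.log_mono_right (by omega)
  have h3 : Nat.log 2 r ≤ Nat.log 2 (N + 2) := Nat.log_mono_right (by omega)
  have h4 := le_mul_log (c + 38) N
  have h5 : (c + 50) * Nat.log 2 (N + 2)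
    = 12 * Nat.log 2 (N + 2) + (c + 38) * Nat.log 2 (N + 2) := by ring
  omega

end FixedPoints

/-! ### Useful strings remain useful for z. -/

section Usefulness

variable {D : BitString → BitString →. BitString}

theorem useful_iff {c N : ℕ} {p x y : BitString} :
    Useful D c N p x y ↔ condC D x (pair p y) ≤ c * Nat.log 2 (N + 2) := by
  rw [Useful, ← Nat.cast_zero, approxEq_natCast]
  omega

/-- Transfers the two assumptions on p from x, y to u, w: usefulness becomes a short program from
(p, w) to u, and a lower bound on the complexity of z passes to the condition (p, u, w). -/
theorem IsOptimal.exists_condC_fingerprint_le (hD : IsOptimal D) :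
    ∃ c : ℕ, ∀ p x y z u w e, condC D u x ≤ e → condC D w y ≤ e → condC D y w ≤ e →
      condC D u (pair p w) ≤ 2 * condC D x (pair p y) + 5 * e + c ∧
      condC D z (pair p (pair x y)) ≤ condC D z (pair p (pair u w)) + 6 * e + c := by
  obtain ⟨c₁, h₁⟩ := hD.exists_condC_trans
  obtain ⟨c₂, h₂⟩ := hD.exists_condC_pair_le
  obtain ⟨c₃, h₃⟩ := hD.condC_apply_le primrec_pairFst
  obtain ⟨c₄, h₄⟩ := hD.condC_apply_le primrec_pairSnd
  obtain ⟨c₅, h₅⟩ := hD.condC_apply_le (primrec_pairFst.comp primrec_pairSnd)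
  obtain ⟨c₆, h₆⟩ := hD.condC_apply_le (primrec_pairSnd.comp primrec_pairSnd)
  refine ⟨20 * (c₁ + c₂ + c₃ + c₄ + c₅ + c₆), fun p x y z u w e hux hwy hyw => ?_⟩
  have k₁ := (h₁ x u (pair p w)).2
  have k₂ := (h₁ (pair p y) x (pair p w)).2
  have k₃ := h₂ p y (pair p w)
  have k₄ := (h₁ w y (pair p w)).2
  have k₅ := h₃ (pair p w)
  have k₆ := h₄ (pair p w)
  have l₁ := (h₁ (pair p (pair u w)) z (pair p (pair x y))).2
  have l₂ := h₂ p (pair u w) (pair p (pair x y))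
  have l₃ := h₂ u w (pair p (pair x y))
  have l₄ := (h₁ x u (pair p (pair x y))).2
  have l₅ := (h₁ y w (pair p (pair x y))).2
  have l₆ := h₃ (pair p (pair x y))
  have l₇ := h₅ (pair p (pair x y))
  have l₈ := h₆ (pair p (pair x y))
  simp only [pairFst_pair, pairSnd_pair] at k₅ k₆ l₆ l₇ l₈
  constructor <;> omega

/-- A short program from (p, w) to u makes u a fixed point on the line. Many fixed points would make
z too simple given p, u, w, so there are few, which makes u, and with it x, simple given p and z. -/
theorem IsOptimal.exists_condC_le_of_isWitness (hD : IsOptimal D) (c c₂ : ℕ) :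
    ∃ c₃ : ℕ, ∀ n r x y z p N, 1 ≤ n → N = x.length + y.length + z.length + p.length →
      IsWitness D c n r x y z →
      condC D z (pair x y) ≤ condC D z (pair p (pair x y)) + c₂ * Nat.log 2 (N + 2) →
      condC D x (pair p y) ≤ c₂ * Nat.log 2 (N + 2) →
      condC D x (pair p z) ≤ c₃ * Nat.log 2 (N + 2) := by
  obtain ⟨a₁, h₁⟩ := hD.exists_condC_fingerprint_le
  obtain ⟨a₂, h₂⟩ := hD.exists_condC_line_add_le
  obtain ⟨a₃, h₃⟩ := hD.exists_condC_fixed_le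
  obtain ⟨a₄, h₄⟩ := hD.exists_condC_trans
  -- Times log N, E bounds the length of g, and G collects every loss in the nonrandomness estimate
  -- except 8s. Since G does not depend on s, the choice s = G + 8 ensures 2^s > G + 8s.
  set E := 2 * c₂ + 5 * c + a₁ with hE
  set G := 6 * c + a₁ + c₂ + 1 + 2 * E + 4 + a₂ with hG
  set s := G + 8 with hs
  refine ⟨2 * (2 * E + 2 ^ s + a₃) + c + a₄, ?_⟩
  rintro n r x y z p N hn hN ⟨u, w, hu, hw, ⟨hzl, hz⟩, hC⟩ hpz hpx
  set ℓ := Nat.log 2 (N + 2) with hℓ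
  have hℓ1 : 1 ≤ ℓ := one_le_log N
  have he : c * Nat.log 2 (x.length + y.length + z.length + 2) ≤ c * ℓ :=
    mul_log_mono (by omega)
  obtain ⟨k₁, k₂⟩ := h₁ p x y z u w (c * ℓ) (hu.2.2.trans he) (hw.2.2.trans he)
    (hw.2.1.trans he)
  have ha₁ : a₁ ≤ a₁ * ℓ := Nat.le_mul_of_pos_right _ hℓ1
  have ha₄ : a₄ ≤ a₄ * ℓ := Nat.le_mul_of_pos_right _ hℓ1
  have hEℓ : E * ℓ = 2 * (c₂ * ℓ) + 5 * (c * ℓ) + a₁ * ℓ := by rw [hE]; ring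
  obtain ⟨g, hg, hgl⟩ := hD.exists_program u (pair p w)
  have hfix : IsFixed D n g p z u := ⟨w, hz, hg⟩
  -- Otherwise C(z|p,u,w) would be below n + r by more than the independence of p and z allows.
  have hfew : ¬ ∃ F : Finset BitString, F.card = 2 ^ (2 ^ s * ℓ) ∧
      ∀ u' ∈ F, u' ≠ u ∧ IsFixed D n g p z u' := fun hF => by
    have k₃ := h₂ n r N g p z u w s ℓ hn (by omega) (by omega) hzl hz hF
    rw [← hℓ] at k₃
    have hGℓ : G * ℓ = 6 * (c * ℓ) + a₁ * ℓ + c₂ * ℓ + ℓ + 2 * (E * ℓ) + 4 * ℓ + a₂ * ℓ := by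
      rw [hG]; ring
    have k₄ : 2 ^ s * ℓ ≤ G * ℓ + 8 * s := by omega
    have k₅ : G + 1 ≤ 2 ^ G := Nat.lt_two_pow_self
    have k₆ : G + 8 * s < 2 ^ s := by rw [hs, pow_add]; omega
    have k₇ : (G + 8 * s + 1) * ℓ ≤ 2 ^ s * ℓ := Nat.mul_le_mul_right _ k₆
    have k₈ : (G + 8 * s + 1) * ℓ = G * ℓ + (8 * s) * ℓ + ℓ := by ring
    have k₉ : 8 * s ≤ (8 * s) * ℓ := Nat.le_mul_of_pos_right _ hℓ1
    omega
  have k₃ := h₃ n (2 ^ s * ℓ) N g p z u (by omega) hfix hfew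
  rw [← hℓ] at k₃
  have k₄ := (h₄ u x (pair p z)).2
  have k₅ : (2 * (2 * E + 2 ^ s + a₃) + c + a₄) * ℓ
    = 4 * (E * ℓ) + 2 * (2 ^ s * ℓ) + 2 * (a₃ * ℓ) + c * ℓ + a₄ * ℓ := by ring
  have k₆ := hu.2.1
  omega

/-- The complexity of z given x and given y is already about the length of z, which bounds the plain
complexity from above, so all these quantities agree. Symmetry of information supplies the lower
bound on C(x|y) from the one on C(y|x). -/
theorem IsOptimal.exists_line_claims (hD : IsOptimal D) (c₀ c : ℕ) :
    ∃ c₁ : ℕ, ∀ n r x y z N, N = x.length + y.length + z.length →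
      z.length = n + n + r → (z = [] ∨ 1 ≤ n ∧ IsWitness D c n r x y z) →
      ApproxEq c₀ (x.length + y.length) (plainC D x) n →
      ApproxEq c₀ (x.length + y.length) (plainC D y) n →
      ApproxEq c₀ (x.length + y.length) (info D x y) 0 →
      ApproxEq c₁ N (plainC D z) z.length ∧ ApproxEq c₁ N (info D x z) 0 ∧
        ApproxEq c₁ N (info D y z) 0 := by
  obtain ⟨c₂, h₂⟩ := hD.exists_symmetry
  obtain ⟨c₃, h₃⟩ := hD.condC_le_plainC
  obtain ⟨c₄, h₄⟩ := hD.condC_le_length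
  obtain ⟨c', h'⟩ := hD.exists_condC_ge_of_isWitness (2 * c₀ + c₂) c
  refine ⟨c' + c₃ + c₄, ?_⟩
  rintro n r x y z N rfl hzl hz hx hy hxy
  simp only [info, approxEq_sub_zero, approxEq_natCast] at *
  set N := x.length + y.length + z.length with hN
  have hmono := mul_log_mono (c := c₀) (show x.length + y.length ≤ N by omega)
  have hmono' : (2 * c₀ + c₂) * Nat.log 2 (N + 2)
    = 2 * (c₀ * Nat.log 2 (N + 2)) + c₂ * Nat.log 2 (N + 2) := by ring
  have hlow : z.length ≤ condC D z x + c' * Nat.log 2 (N + 2) ∧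
      z.length ≤ condC D z y + c' * Nat.log 2 (N + 2) := by
    rcases hz with rfl | ⟨hn, hz⟩
    · simp
    · have hsym := h₂ x y N (by omega)
      rw [hzl]
      exact h' n r x y z N hn hN hz (by omega) (by omega)
  have k₁ := h₃ z x
  have k₂ := h₃ z y
  have k₃ : plainC D z ≤ z.length + c₄ := h₄ z []
  have k₄ := le_mul_log c₃ N
  have k₅ := le_mul_log c₄ N
  have k₆ : (c' + c₃ + c₄) * Nat.log 2 (N + 2)
    = c' * Nat.log 2 (N + 2) + c₃ * Nat.log 2 (N + 2) + c₄ * Nat.log 2 (N + 2) := by ring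
  refine ⟨⟨?_, ?_⟩, ⟨?_, ?_⟩, ?_, ?_⟩ <;> omega

/-- For a line `z` in general position, every string that is independent of `z` given `x, y` and
useful to get `x` from `y` is useful to get `x` from `z`. -/
theorem IsOptimal.exists_line_function (hD : IsOptimal D) (c₀ : ℕ) :
    ∃ Z : ℕ → ℕ → BitString → BitString → BitString,
      (∃ c₁ : ℕ, ∀ (d n : ℕ) (x y : BitString), 1 ≤ d →
        ApproxEq c₀ (x.length + y.length) (plainC D x) n →
        ApproxEq c₀ (x.length + y.length) (plainC D y) n →
        ApproxEq c₀ (x.length + y.length) (info D x y) 0 →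
        (Z d n x y).length = (d + 1) * n ∧
        ApproxEq c₁ (x.length + y.length + (Z d n x y).length)
          (plainC D (Z d n x y)) ((d + 1) * n) ∧
        ApproxEq c₁ (x.length + y.length + (Z d n x y).length) (info D x (Z d n x y)) 0 ∧
        ApproxEq c₁ (x.length + y.length + (Z d n x y).length) (info D y (Z d n x y)) 0) ∧
      (∀ c₂ : ℕ, ∃ c₃ : ℕ, ∀ (d n : ℕ) (x y : BitString), 1 ≤ d →
        ApproxEq c₀ (x.length + y.length) (plainC D x) n →
        ApproxEq c₀ (x.length + y.length) (plainC D y) n →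
        ApproxEq c₀ (x.length + y.length) (info D x y) 0 →
        ∀ p : BitString,
        ApproxEq c₂ (x.length + y.length + (Z d n x y).length + p.length)
          (condInfo D p (Z d n x y) (pair x y)) 0 →
        Useful D c₂ (x.length + y.length + (Z d n x y).length + p.length) p x y →
        Useful D c₃ (x.length + y.length + (Z d n x y).length + p.length) p x (Z d n x y)) := by
  classical
  obtain ⟨c, hc⟩ := hD.exists_isWitness c₀
  -- With r = (d - 1) * n the length 2n + r is (d + 1) * n. There is no line to use for n = 0, where
  -- the default empty string has the right length.
  set Z : ℕ → ℕ → BitString → BitString → BitString := fun d n x y =>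
    if h : 1 ≤ n ∧ ∃ z, IsWitness D c n ((d - 1) * n) x y z then h.2.choose else [] with hZdef
  have hZ0 : ∀ d x y, Z d 0 x y = [] := fun d x y => by
    rw [hZdef]
    simp
  have hZ : ∀ (d n : ℕ) (x y : BitString), 1 ≤ n →
      ApproxEq c₀ (x.length + y.length) (plainC D x) n →
      ApproxEq c₀ (x.length + y.length) (plainC D y) n →
      IsWitness D c n ((d - 1) * n) x y (Z d n x y) := fun d n x y hn hx hy => by
    have h : 1 ≤ n ∧ ∃ z, IsWitness D c n ((d - 1) * n) x y z :=
      ⟨hn, hc n _ x y hn (approxEq_natCast.1 hx).1 (approxEq_natCast.1 hy).1⟩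
    rw [hZdef]
    simp only [dif_pos h]
    exact h.2.choose_spec
  refine ⟨Z, ?_, ?_⟩
  · obtain ⟨c₁, h₁⟩ := hD.exists_line_claims c₀ c
    refine ⟨c₁, fun d n x y hd hx hy hxy => ?_⟩
    have hmul : (d + 1) * n = n + n + (d - 1) * n := by
      obtain ⟨m, rfl⟩ := Nat.exists_eq_add_of_le' hd
      simp only [Nat.add_sub_cancel]
      ring
    have hlen : (Z d n x y).length = (d + 1) * n ∧ (Z d n x y = [] ∨ 1 ≤ n ∧
        IsWitness D c n ((d - 1) * n) x y (Z d n x y)) := by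
      rcases Nat.eq_zero_or_pos n with rfl | hn
      · simp [hZ0]
      · have h := hZ d n x y hn hx hy
        obtain ⟨u, w, -, -, ⟨hl, -⟩, -⟩ := id h
        exact ⟨hl.trans hmul.symm, Or.inr ⟨hn, h⟩⟩
    have h := h₁ n _ x y (Z d n x y) _ rfl (hlen.1.trans hmul) hlen.2 hx hy hxy
    refine ⟨hlen.1, ?_, h.2⟩
    have h3 := h.1
    nth_rw 2 [hlen.1] at h3
    push_cast at h3
    exact h3
  · intro c₂
    obtain ⟨c₃, h₃⟩ := hD.exists_condC_le_of_isWitness c c₂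
    obtain ⟨c₄, h₄⟩ := hD.condC_le_plainC
    refine ⟨c₃ + c₀ + c₄, fun d n x y hd hx hy hxy p hp hpx => ?_⟩
    rw [useful_iff] at hpx ⊢
    rw [condInfo, approxEq_sub_zero, approxEq_natCast] at hp
    set N := x.length + y.length + (Z d n x y).length + p.length with hN
    have k₁ : (c₃ + c₀ + c₄) * Nat.log 2 (N + 2)
      = c₃ * Nat.log 2 (N + 2) + c₀ * Nat.log 2 (N + 2) + c₄ * Nat.log 2 (N + 2) := by ring
    rcases Nat.eq_zero_or_pos n with rfl | hn
    -- For n = 0 the string x itself has complexity O(log N), so it is simple under every condition.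
    · have k₂ := (approxEq_natCast.1 hx).1
      have k₃ := mul_log_mono (c := c₀) (show x.length + y.length ≤ N by omega)
      have k₄ := h₄ x (pair p (Z d 0 x y))
      have k₅ := le_mul_log c₄ N
      omega
    · have := h₃ n _ x y (Z d n x y) p N hn hN (hZ d n x y hn hx hy) hp.1 hpx
      omega

end Usefulness

/-! ### The negative answer: linear complexity against the logarithm of a polynomial. -/

section NegativeAnswer

theorem eval_le_mul_pow (Q : Polynomial ℕ) {n : ℕ} (hn : 1 ≤ n) :
    Q.eval n ≤ Q.eval 1 * n ^ Q.natDegree := by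
  rw [Polynomial.eval_eq_sum_range, Polynomial.eval_eq_sum_range, Finset.sum_mul]
  refine Finset.sum_le_sum fun i hi => ?_
  rw [one_pow, mul_one]
  exact Nat.mul_le_mul_left _ (Nat.pow_le_pow_right hn (by
    have := Finset.mem_range.1 hi
    omega))

theorem exists_add_mul_lt_two_pow (a b : ℕ) : ∃ m, a + b * m < 2 ^ m := by
  refine ⟨2 * (a + 2 * b + 1), ?_⟩
  set i := a + 2 * b + 1 with hi
  have h : i + 1 ≤ 2 ^ i := Nat.lt_two_pow_self
  rw [two_mul, pow_add]
  have h1 : (i + 1) * (i + 1) ≤ 2 ^ i * 2 ^ i := Nat.mul_le_mul h h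
  nlinarith

/-- The logarithm of a polynomial grows slower than linearly. -/
theorem exists_mul_log_eval_lt (K : ℕ) (Q : Polynomial ℕ) :
    ∃ n, K * Nat.log 2 (Q.eval n + 2) < n := by
  obtain ⟨m, hm⟩ := exists_add_mul_lt_two_pow (K * (Q.eval 1 + 2)) (K * Q.natDegree)
  refine ⟨2 ^ m, lt_of_le_of_lt ?_ hm⟩
  have h1 := eval_le_mul_pow Q (Nat.one_le_two_pow (n := m))
  rw [← pow_mul] at h1
  have h2 : Nat.log 2 (Q.eval (2 ^ m) + 2) ≤ (Q.eval 1 + 2) + m * Q.natDegree := by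
    rw [← Nat.log_pow (b := 2) (by norm_num) ((Q.eval 1 + 2) + m * Q.natDegree)]
    refine Nat.log_mono_right ?_
    rw [pow_add]
    have h3 : Q.eval 1 + 2 ≤ 2 ^ (Q.eval 1 + 2) := Nat.lt_two_pow_self.le
    have h4 : 1 ≤ 2 ^ (m * Q.natDegree) := Nat.one_le_two_pow
    nlinarith
  calc K * Nat.log 2 (Q.eval (2 ^ m) + 2)
      ≤ K * ((Q.eval 1 + 2) + m * Q.natDegree) := Nat.mul_le_mul_left _ h2
    _ = K * (Q.eval 1 + 2) + K * Q.natDegree * m := by ring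

variable {D : BitString → BitString →. BitString}

theorem IsOptimal.exists_no_useful (hD : IsOptimal D) (P : Polynomial ℕ) (c : ℕ) :
    ∃ x y z : BitString, ∀ p : BitString,
      p.length ≤ P.eval (x.length + y.length + z.length) →
      ApproxEq c (x.length + y.length + z.length + p.length) (condInfo D p z (pair x y)) 0 →
      Useful D c (x.length + y.length + z.length + p.length) p x y →
      ¬ ApproxEq c (x.length + y.length + z.length + p.length) (condC D x (pair p z))
          (min (condC D x z) (condC D y z) : ℕ) := by
  obtain ⟨a₁, h₁⟩ := hD.condC_le_length
  obtain ⟨a₂, h₂⟩ := hD.condC_le_plainC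
  obtain ⟨a₃, h₃⟩ := hD.exists_symmetry
  obtain ⟨Z, ⟨c₁, hZ₁⟩, hZ₂⟩ := hD.exists_line_function (a₁ + a₂)
  obtain ⟨c₃, hZ₂⟩ := hZ₂ c
  -- The lengths of x, y and z add up to n + n + 2n = 4n, so this polynomial bounds the total length
  -- together with p. The factor is the sum of all logarithmic losses below.
  obtain ⟨n, hn⟩ := exists_mul_log_eval_lt (c₁ + a₂ + a₃ + c₃ + c)
    (4 * Polynomial.X + P.comp (4 * Polynomial.X))
  obtain ⟨x, hx, hxC⟩ := hD.exists_condC_ge [] (card_strings n).ge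
  obtain ⟨y, hy, hyC⟩ := hD.exists_condC_ge x (card_strings n).ge
  rw [mem_strings] at hx hy
  have e₁ := h₁ x []
  have e₂ := h₁ y []
  have e₃ := h₂ y x
  have e₄ := le_mul_log (a₁ + a₂) (x.length + y.length)
  have hx' : ApproxEq (a₁ + a₂) (x.length + y.length) (plainC D x) n := by
    rw [approxEq_natCast]; unfold plainC at *; omega
  have hy' : ApproxEq (a₁ + a₂) (x.length + y.length) (plainC D y) n := by
    rw [approxEq_natCast]; unfold plainC at *; omega
  have hxy' : ApproxEq (a₁ + a₂) (x.length + y.length) (info D x y) 0 := by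
    rw [info, approxEq_sub_zero, approxEq_natCast]; unfold plainC at *; omega
  obtain ⟨hl, -, hxz, hyz⟩ := hZ₁ 1 n x y le_rfl hx' hy' hxy'
  refine ⟨x, y, Z 1 n x y, fun p hpl hp hpx hmin => ?_⟩
  have hu := hZ₂ 1 n x y le_rfl hx' hy' hxy' p hp hpx
  rw [useful_iff] at hu
  set z := Z 1 n x y with hz
  set N := x.length + y.length + z.length with hN
  have hN4 : N = 4 * n := by omega
  rw [approxEq_natCast] at hmin
  simp only [info, approxEq_sub_zero, approxEq_natCast] at hxz hyz
  -- Symmetry turns the independence of z from x and from y into lower bounds of about n for C(x|z)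
  -- and C(y|z), hence for the minimum.
  have k₁ := h₃ x z N (by omega)
  have k₂ := h₃ y z N (by omega)
  have k₃ : ∀ a, a * Nat.log 2 (N + 2) ≤ a * Nat.log 2 (N + p.length + 2) := fun a =>
    mul_log_mono (by omega)
  have k₄ := k₃ c₁
  have k₅ := k₃ a₃
  have k₆ := le_mul_log a₂ (N + p.length)
  have k₇ : (c₁ + a₂ + a₃ + c₃ + c) * Nat.log 2 (N + p.length + 2)
    = c₁ * Nat.log 2 (N + p.length + 2) + a₂ * Nat.log 2 (N + p.length + 2)
      + a₃ * Nat.log 2 (N + p.length + 2) + c₃ * Nat.log 2 (N + p.length + 2)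
      + c * Nat.log 2 (N + p.length + 2) := by ring
  have k₈ : N + p.length ≤ (4 * Polynomial.X + P.comp (4 * Polynomial.X)).eval n := by
    simp only [Polynomial.eval_add, Polynomial.eval_mul, Polynomial.eval_ofNat,
      Polynomial.eval_X, Polynomial.eval_comp]
    rw [hN4] at hpl
    omega
  have k₉ := mul_log_mono (c := c₁ + a₂ + a₃ + c₃ + c) k₈
  unfold plainC at *
  omega

end NegativeAnswer

end BitString

open BitString
theorem proposition4
    (D : BitString → BitString →. BitString) (hD : IsOptimal D) :
    (∀ c₀ : ℕ, ∃ Z : ℕ → ℕ → BitString → BitString → BitString,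
      (∃ c₁ : ℕ, ∀ (d n : ℕ) (x y : BitString), 1 ≤ d →
        ApproxEq c₀ (x.length + y.length) (plainC D x) n →
        ApproxEq c₀ (x.length + y.length) (plainC D y) n →
        ApproxEq c₀ (x.length + y.length) (info D x y) 0 →
        (Z d n x y).length = (d + 1) * n ∧
        ApproxEq c₁ (x.length + y.length + (Z d n x y).length)
          (plainC D (Z d n x y)) ((d + 1) * n) ∧
        ApproxEq c₁ (x.length + y.length + (Z d n x y).length) (info D x (Z d n x y)) 0 ∧
        ApproxEq c₁ (x.length + y.length + (Z d n x y).length) (info D y (Z d n x y)) 0) ∧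
      (∀ (P : Polynomial ℕ) (c₂ : ℕ), ∃ c₃ : ℕ, ∀ (d n : ℕ) (x y : BitString), 1 ≤ d →
        ApproxEq c₀ (x.length + y.length) (plainC D x) n →
        ApproxEq c₀ (x.length + y.length) (plainC D y) n →
        ApproxEq c₀ (x.length + y.length) (info D x y) 0 →
        ∀ p : BitString, p.length ≤ P.eval n →
        ApproxEq c₂ (x.length + y.length + (Z d n x y).length + p.length)
          (condInfo D p (Z d n x y) (pair x y)) 0 →
        Useful D c₂ (x.length + y.length + (Z d n x y).length + p.length) p x y →
        Useful D c₃ (x.length + y.length + (Z d n x y).length + p.length) p x (Z d n x y))) ∧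
    (∀ (P : Polynomial ℕ) (c : ℕ), ∃ x y z : BitString, ∀ p : BitString,
      p.length ≤ P.eval (x.length + y.length + z.length) →
      ApproxEq c (x.length + y.length + z.length + p.length) (condInfo D p z (pair x y)) 0 →
      Useful D c (x.length + y.length + z.length + p.length) p x y →
      ¬ ApproxEq c (x.length + y.length + z.length + p.length) (condC D x (pair p z))
          (min (condC D x z) (condC D y z) : ℕ)) := by
  refine ⟨fun c₀ => ?_, hD.exists_no_useful⟩
  obtain ⟨Z, h₁, h₂⟩ := hD.exists_line_function c₀
  refine ⟨Z, h₁, fun _ c₂ => ?_⟩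
  obtain ⟨c₃, h₃⟩ := h₂ c₂
  exact ⟨c₃, fun d n x y hd hx hy hxy p _ => h₃ d n x y hd hx hy hxy p⟩
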